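/- **Setting.** Let $\Omega\subset\mathbb R^n$ be a domain, $\Omega_0\subset\Omega$ a bounded subdomain, and $\Gamma_D\subset\partial\Omega\cap\partial\Omega_0$. Let $$L(u,v)=\int_{\Omega_0}\big(A\nabla u\cdot\nabla v+(b\cdot\nabla u)\,v+c\,uv\big)\,dx ,$$ where the entries of $A$ (a positive definite, not necessarily symmetric, $n\times n$ matrix), $b$ and $c$ are measurable on $\Omega_0$ and bounded there by $\Lambda$. Put $H^1_{D,0}(\Omega_0)=\{u\in H^1(\Omega_0): u|_{\Gamma_D}=0\}$ and, for $B\subset\Omega_0$, let $H^1_<(B)$ be the set of functions that, extended by zero outside $B$, belong to $H^1(\Omega)$. For sets $X,Y$, $\mathrm{dist}(X,Y)=\inf_{x\in X,\,y\in Y}|x-y|$ ($=\infty$ if $X$ or $Y$ is empty). Let $\mathcal T$ be a triangulation: a finite family of pairwise disjoint, bounded, connected open elements $T\subset\Omega$ with boundaries of measure zero (e.g. open simplices), each meeting $\Omega_0$, with $\Omega_0\subset\bigcup_{T\in\mathcal T}\overline T$; put $h_T=\mathrm{diam}(T)$. Let $S_D$ be a linear space of functions (the trial space) and $S_{D,0}=S_D\cap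 H^1_{D,0}(\Omega_0)$. **Assumptions.** * R1 (local coercivity). There are $d_0>0$ and $C_1>0$ such that, whenever $B$ is the intersection of $\Omega_0$ with an open ball of diameter at most $d_0$, $$C_1^{-1}\|u\|_{H^1(B)}^2\le L(u,u)\le C_1\|u\|_{H^1(B)}^2\qquad\text{for all } u\in H^1_<(B).$$ * A2 (inverse properties). For some integer $r_2\ge1$ and some constant $C_2$, for all $\chi\in S_D$, $T\in\mathcal T$, $1\le p\le q\le\infty$ and integers $0\le\nu\le s\le r_2$, $$\|\chi\|_{W^s_q(T)}\le C_2\,h_T^{\nu-s+\frac np-\frac nq}\,\|\chi\|_{W^\nu_p(T)} .$$ Let $G_0\subset G\subset\Omega_0$ with $\mathrm{dist}(G_0,\partial G\setminus\partial\Omega)=d$, where $0<d\le 2d_0$, and assume further, for some integer $r_3\ge0$ and some function $K\mapsto C_3(K)$, that for all open sets $G_1\subset G_2\subset G$ with $\mathrm{dist}(G_1,\partial G_2\setminus\partial\Omega)=\frac d4$ there is a map $I$ with the following two properties. * A1 (local interpolant). $Iu\in S_D\cap H^1_<(G_2)$ for each $u\in H^1_<(G_1)$, and $Iu\in S_{D,0}$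 for each $u\in H^1_{D,0}(\Omega_0)$. * A3 (superapproximation). For each $K>0$, each $\omega\in C^\infty(\Omega_0)\cap H^1_<(G_1)$ with $|D^j\omega|\le K d^{-j}$ on $\Omega_0$ for all integers $0\le j\le r_3$, each $\chi\in S_{D,0}$, and each $T\in\mathcal T$ with $h_T\le d$, $$\|\omega^2\chi-I(\omega^2\chi)\|_{H^1(T)}\le C_3(K)\Big(\frac{h_T}{d}\|\nabla(\omega\chi)\|_{L_2(T)}+\frac{h_T}{d^2}\|\chi\|_{L_2(T)}\Big).$$ **Claim (discrete Caccioppoli estimate).** Suppose in addition that $h_T/d\le\frac14$ for every $T\in\mathcal T$ with $T\cap G\ne\emptyset$, and that $u_h\in S_{D,0}$ is discrete harmonic, i.e. $$L(u_h,v_h)=0\qquad\text{for all } v_h\in S_{D,0}\cap H^1_<(\Omega_0).$$ Then $$\|u_h\|_{H^1(G_0)}\le \frac Cd\,\|u_h\|_{L_2(G)},$$ where $C>0$ depends only on $n,r_2,r_3$, on $\Lambda$ and $C_1$ (that is, on $L$), and on the constants $C_2$ and $C_3(\cdot)$ of A2 and A3. In particular it does not depend on $d$, $G_0$, $G$, the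 mesh, $S_D$ or $u_h$. -/

import Mathlib

open MeasureTheory Set Filter Topology
open scoped ENNReal ContDiff

noncomputable section

namespace LocalFEM

/-- Euclidean space of dimension `n`. -/
abbrev E (n : ℕ) := EuclideanSpace ℝ (Fin n)

/-- Multi-indices of length `n`. -/
abbrev MultiIndex (n : ℕ) := Fin n → ℕ

/-- The order of a multi-index. -/
def order {n : ℕ} (α : MultiIndex n) : ℕ := ∑ i, α i

/-- The finite set of all multi-indices of order at most `k`. -/
def multiIndicesLE (n k : ℕ) : Finset (MultiIndex n) :=
  (Finset.Iic (fun _ : Fin n => k)).filter (fun α => order α ≤ k)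

/-- The classical partial derivative in direction `e_i`. -/
def partialDeriv {n : ℕ} (i : Fin n) (f : E n → ℝ) : E n → ℝ :=
  fun x => fderiv ℝ f x (EuclideanSpace.single i (1 : ℝ))

/-- The classical derivative `D^α f` (used for smooth `f` only). -/
def multiDeriv {n : ℕ} (α : MultiIndex n) (f : E n → ℝ) : E n → ℝ :=
  (List.finRange n).foldr (fun i g => (partialDeriv i)^[α i] g) f

/-! ### Sobolev norms -/

/-- On the open set `U`, the function `g` is a weak derivative `D^α u`. -/
structure IsWeakDeriv {n : ℕ} (U : Set (E n)) (α : MultiIndex n) (u g : E n → ℝ) : Prop where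
  locallyIntegrable : LocallyIntegrableOn u U
  locallyIntegrable_deriv : LocallyIntegrableOn g U
  integral_eq : ∀ φ : E n → ℝ, ContDiff ℝ ∞ φ → HasCompactSupport φ → tsupport φ ⊆ U →
    ∫ x in U, u x * multiDeriv α φ x = (-1) ^ order α * ∫ x in U, g x * φ x

/-- `u` possesses a weak derivative `D^α u` on `U`. -/
def HasWeakDeriv {n : ℕ} (U : Set (E n)) (α : MultiIndex n) (u : E n → ℝ) : Prop :=
  ∃ g, IsWeakDeriv U α u g

open Classical in
/-- The weak derivative `D^α u` on the open set `U` (almost everywhere unique if it exists). -/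
def weakDeriv {n : ℕ} (U : Set (E n)) (α : MultiIndex n) (u : E n → ℝ) : E n → ℝ :=
  if h : HasWeakDeriv U α u then h.choose else 0

/-- The first weak partial derivative `∂_i u` on `U`. -/
def weakPartial {n : ℕ} (U : Set (E n)) (i : Fin n) (u : E n → ℝ) : E n → ℝ :=
  weakDeriv U (Pi.single i 1) u

/-- The `ℓ^p` combination of the `L_p(D)` norms of `D^α u`, `α ∈ s`, the weak derivatives being
taken on the open set `U ⊇ D`: `(∑ ‖D^α u‖_{L_p(D)}^p)^{1/p}`, and the maximum for `p = ∞`.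
It is `∞` if one of the derivatives does not exist. -/
def derivNorm {n : ℕ} (U D : Set (E n)) (s : Finset (MultiIndex n)) (p : ℝ≥0∞)
    (u : E n → ℝ) : ℝ≥0∞ :=
  open Classical in
  if ∀ α ∈ s, HasWeakDeriv U α u then
    if p = ⊤ then s.sup (fun α => eLpNorm (weakDeriv U α u) ⊤ (volume.restrict D))
    else (∑ α ∈ s, eLpNorm (weakDeriv U α u) p (volume.restrict D) ^ p.toReal) ^ (1 / p.toReal)
  else ⊤

/-- The norm of `W_p^k(U)` for an open set `U`; it is finite exactly on `W_p^k(U)`. -/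
def sobolevNorm {n : ℕ} (U : Set (E n)) (k : ℕ) (p : ℝ≥0∞) (u : E n → ℝ) : ℝ≥0∞ :=
  derivNorm U U (multiIndicesLE n k) p u

/-- The norm of `H¹(D)` of a function in `H¹(U)`, where `D` is a subset of the open set `U`:
`(∫_D u² + |∇u|²)^{1/2}`. For open `D` this is the usual norm of `H¹(D)`. -/
def h1NormOn {n : ℕ} (U D : Set (E n)) (u : E n → ℝ) : ℝ≥0∞ :=
  derivNorm U D (multiIndicesLE n 1) 2 u

/-- `‖∇u‖_{L_2(U)}`. -/
def gradNorm {n : ℕ} (U : Set (E n)) (u : E n → ℝ) : ℝ≥0∞ :=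
  derivNorm U U (Finset.univ.image (fun i : Fin n => (Pi.single i 1 : MultiIndex n))) 2 u

/-- `‖u‖_{L_2(D)}`. -/
def l2Norm {n : ℕ} (D : Set (E n)) (u : E n → ℝ) : ℝ≥0∞ :=
  eLpNorm u 2 (volume.restrict D)

/-- The space `H¹(U)`. -/
def H1 {n : ℕ} (U : Set (E n)) : Set (E n → ℝ) := {u | sobolevNorm U 1 2 u < ⊤}

/-- `u|_Γ = 0` in the sense of traces from `U`: at almost every point of `Γ`, with respect to
the `(n-1)`-dimensional surface measure, the means of `|u|` over `B(x,ρ) ∩ U` tend to zero. -/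
def TraceZero {n : ℕ} (U Γ : Set (E n)) (u : E n → ℝ) : Prop :=
  ∀ᵐ x ∂(μH[(n : ℝ) - 1] : Measure (E n)), x ∈ Γ →
    Tendsto (fun ρ : ℝ => ⨍ y in Metric.ball x ρ ∩ U, |u y|) (𝓝[>] 0) (𝓝 0)

/-- `H¹_{D,0}(Ω₀)`: the functions in `H¹(Ω₀)` that vanish on `Γ_D`. -/
def H1D0 {n : ℕ} (Ω₀ ΓD : Set (E n)) : Set (E n → ℝ) := {u | u ∈ H1 Ω₀ ∧ TraceZero Ω₀ ΓD u}

/-- `H¹_<(B)` for `B ⊆ Ω₀ ⊆ Ω`: the `H¹` functions that vanish on `Ω \ B`. They are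
zero on `∂B \ ∂Ω` because they belong to `H¹` across that part of `∂B`. -/
def H1Lt {n : ℕ} (Ω B : Set (E n)) : Set (E n → ℝ) :=
  {u | u ∈ H1 Ω ∧ ∀ᵐ x, x ∈ Ω \ B → u x = 0}

/-! ### The differential operator -/

/-- The coefficients of `-div(A ∇u) + b · ∇u + c u`. -/
structure Coeffs (n : ℕ) where
  A : E n → Matrix (Fin n) (Fin n) ℝ
  b : E n → E n
  c : E n → ℝ

/-- The coefficients are measurable and bounded by `Λ` on `Ω₀`, and `A` is positive definite
(not necessarily symmetric). -/
structure Coeffs.Admissible {n : ℕ} (P : Coeffs n) (Ω₀ : Set (E n)) (Λ : ℝ) : Prop where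
  measurable_A : ∀ i j, AEMeasurable (fun x => P.A x i j) (volume.restrict Ω₀)
  measurable_b : ∀ i, AEMeasurable (fun x => P.b x i) (volume.restrict Ω₀)
  measurable_c : AEMeasurable P.c (volume.restrict Ω₀)
  bound_A : ∀ᵐ x ∂(volume.restrict Ω₀), ∀ i j, |P.A x i j| ≤ Λ
  bound_b : ∀ᵐ x ∂(volume.restrict Ω₀), ‖P.b x‖ ≤ Λ
  bound_c : ∀ᵐ x ∂(volume.restrict Ω₀), |P.c x| ≤ Λ
  posDef_A : ∀ᵐ x ∂(volume.restrict Ω₀), ∀ ξ : Fin n → ℝ, ξ ≠ 0 →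
    0 < ∑ i, ∑ j, P.A x i j * ξ j * ξ i

/-- The bilinear form `L(u,v) = ∫ (A ∇u · ∇v + (b · ∇u) v + c u v) dx`, over `Ω₀`. -/
def Coeffs.form {n : ℕ} (P : Coeffs n) (Ω₀ : Set (E n)) (u v : E n → ℝ) : ℝ :=
  ∫ x in Ω₀, ((∑ i, ∑ j, P.A x i j * weakPartial Ω₀ j u x * weakPartial Ω₀ i v x)
    + (∑ i, P.b x i * weakPartial Ω₀ i u x) * v x + P.c x * u x * v x)

/-- Local coercivity: `C₁⁻¹ ‖u‖²_{H¹(B)} ≤ L(u,u) ≤ C₁ ‖u‖²_{H¹(B)}` for `u ∈ H¹_<(B)`, whenever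
`B` is the intersection of `Ω₀` with an open ball of diameter at most `d₀`. -/
structure LocallyCoercive {n : ℕ} (P : Coeffs n) (Ω Ω₀ : Set (E n)) (d₀ C₁ : ℝ) : Prop where
  d₀_pos : 0 < d₀
  C₁_pos : 0 < C₁
  coercive : ∀ (z : E n) (ρ : ℝ), 0 < ρ → 2 * ρ ≤ d₀ →
    ∀ u ∈ H1Lt Ω (Metric.ball z ρ ∩ Ω₀),
      C₁⁻¹ * (sobolevNorm (Metric.ball z ρ ∩ Ω₀) 1 2 u).toReal ^ 2 ≤ P.form Ω₀ u u ∧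
      P.form Ω₀ u u ≤ C₁ * (sobolevNorm (Metric.ball z ρ ∩ Ω₀) 1 2 u).toReal ^ 2

/-! ### Meshes and finite element spaces -/

/-- `dist(X, Y) = inf {|x - y|}`, which is `∞` if one of the sets is empty. -/
def setDist {n : ℕ} (X Y : Set (E n)) : ℝ≥0∞ := ⨅ x ∈ X, Metric.infEDist x Y

/-- A triangulation covering `Ω₀`: finitely many disjoint (open) elements in `Ω` that meet `Ω₀`.
The elements may be simplices, but curved elements are admitted as well. -/
structure IsTriangulation {n : ℕ} (Ω Ω₀ : Set (E n)) (𝒯 : Set (Set (E n))) : Prop where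
  finite : 𝒯.Finite
  isOpen : ∀ T ∈ 𝒯, IsOpen T
  isConnected : ∀ T ∈ 𝒯, IsConnected T
  isBounded : ∀ T ∈ 𝒯, Bornology.IsBounded T
  null_frontier : ∀ T ∈ 𝒯, volume (frontier T) = 0
  pairwiseDisjoint : 𝒯.PairwiseDisjoint id
  subset : ∀ T ∈ 𝒯, T ⊆ Ω
  inter_nonempty : ∀ T ∈ 𝒯, (T ∩ Ω₀).Nonempty
  covers : Ω₀ ⊆ ⋃ T ∈ 𝒯, closure T

/-- The element diameter `h_T`. -/
def meshSize {n : ℕ} (T : Set (E n)) : ℝ := Metric.diam T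

/-- `I` is a local interpolant for the pair `G₁ ⊆ G`: it maps `H¹_<(G₁)` to `S_D ∩ H¹_<(G)`, and
`H¹_{D,0}(Ω₀)` to `S_{D,0} = S_D ∩ H¹_{D,0}(Ω₀)`. -/
def IsLocalInterpolant {n : ℕ} (Ω Ω₀ ΓD : Set (E n)) (S : Submodule ℝ (E n → ℝ))
    (G₁ G : Set (E n)) (I : (E n → ℝ) → (E n → ℝ)) : Prop :=
  (∀ u ∈ H1Lt Ω G₁, I u ∈ S ∧ I u ∈ H1Lt Ω G) ∧
  (∀ u ∈ H1D0 Ω₀ ΓD, I u ∈ S ∧ I u ∈ H1D0 Ω₀ ΓD)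

/-- Inverse inequalities of order up to `r`, with constant `C`:
`‖χ‖_{W_q^s(T)} ≤ C h_T^{ν - s + n/p - n/q} ‖χ‖_{W_p^ν(T)}` (with `n/∞ = 0`). -/
def InverseProperties {n : ℕ} (𝒯 : Set (Set (E n))) (S : Submodule ℝ (E n → ℝ))
    (r : ℕ) (C : ℝ) : Prop :=
  ∀ χ ∈ S, ∀ T ∈ 𝒯, ∀ p q : ℝ≥0∞, 1 ≤ p → p ≤ q → ∀ ν s : ℕ, ν ≤ s → s ≤ r →
    sobolevNorm T s q χ ≤
      ENNReal.ofReal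
        (C * meshSize T ^ ((ν : ℝ) - (s : ℝ) + (n : ℝ) / p.toReal - (n : ℝ) / q.toReal)) *
      sobolevNorm T ν p χ

/-- Superapproximation at scale `d` for the interpolant `I`: for all cutoff functions
`η ∈ C^∞(Ω₀) ∩ H¹_<(G₁)` with `|D^j η| ≤ K d^{-j}` on `Ω₀` for `0 ≤ j ≤ r`, all `χ ∈ S_{D,0}`, and all
elements with `h_T ≤ d`. The constant `C K` depends on the constant `K` in the bounds for `η`. -/
def Superapproximation {n : ℕ} (Ω Ω₀ ΓD : Set (E n)) (𝒯 : Set (Set (E n)))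
    (S : Submodule ℝ (E n → ℝ)) (G₁ : Set (E n)) (I : (E n → ℝ) → (E n → ℝ))
    (d : ℝ) (r : ℕ) (C : ℝ → ℝ) : Prop :=
  ∀ K : ℝ, 0 < K → ∀ η : E n → ℝ, ContDiffOn ℝ ∞ η Ω₀ → η ∈ H1Lt Ω G₁ →
    (∀ j : ℕ, j ≤ r → ∀ x ∈ Ω₀, ‖iteratedFDeriv ℝ j η x‖ ≤ K / d ^ j) →
    ∀ χ ∈ S, χ ∈ H1D0 Ω₀ ΓD → ∀ T ∈ 𝒯, meshSize T ≤ d →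
      sobolevNorm T 1 2 (fun x => η x ^ 2 * χ x - I (fun y => η y ^ 2 * χ y) x) ≤
        ENNReal.ofReal (C K) *
          (ENNReal.ofReal (meshSize T / d) * gradNorm T (fun x => η x * χ x) +
            ENNReal.ofReal (meshSize T / d ^ 2) * l2Norm T χ)

/-- For every pair of open subsets `G₁ ⊆ G₂` of `G` with `dist(G₁, ∂G₂ \ ∂Ω) = δ` there is a
local interpolant which has the superapproximation property at scale `d`. -/
def LocalApproximation {n : ℕ} (Ω Ω₀ ΓD : Set (E n)) (𝒯 : Set (Set (E n)))
    (S : Submodule ℝ (E n → ℝ)) (G : Set (E n)) (δ d : ℝ) (r : ℕ) (C : ℝ → ℝ) : Prop :=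
  ∀ G₁ G₂ : Set (E n), IsOpen G₁ → IsOpen G₂ → G₁ ⊆ G₂ → G₂ ⊆ G →
    setDist G₁ (frontier G₂ \ frontier Ω) = ENNReal.ofReal δ →
    ∃ I : (E n → ℝ) → (E n → ℝ), IsLocalInterpolant Ω Ω₀ ΓD S G₁ G₂ I ∧
      Superapproximation Ω Ω₀ ΓD 𝒯 S G₁ I d r C

end LocalFEM

end

open LocalFEM

/-!
Let `ζ` be a cutoff function that equals one on a ball of radius `d / 8` and write `u` for `u_h`.
Local coercivity bounds `‖ζ u‖²_{H¹}` by `L(ζ u, ζ u)`, which differs from `L(u, ζ² u)` only by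
terms with a factor `∇ζ`, hence by at most a multiple of `d⁻¹ ‖u‖ ‖ζ u‖_{H¹} + d⁻² ‖u‖²`. Discrete
harmonicity turns `L(u, ζ² u)` into `L(u, ζ² u - I(ζ² u))`. On each element the inverse inequality
costs a factor `h_T⁻¹`, which superapproximation compensates, so this term obeys the same bound.
Absorbing `‖ζ u‖_{H¹}` gives the estimate on the ball, and covering `G₀` by such balls with bounded
overlap gives the global one.
-/

namespace LocalFEM

variable {n : ℕ}

/-! ### Multi-indices of order at most one -/

lemma order_zero : order (0 : MultiIndex n) = 0 := by simp [order]

lemma order_single (i : Fin n) : order (Pi.single i 1 : MultiIndex n) = 1 := by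
  simp [order]

lemma multiIndicesLE_zero : multiIndicesLE n 0 = {0} := by
  ext α
  simp only [multiIndicesLE, Finset.mem_filter, Finset.mem_Iic, Finset.mem_singleton]
  exact ⟨fun h => le_antisymm h.1 zero_le, fun h => by simp [h, order_zero]⟩

lemma eq_single_of_order_le_one {α : MultiIndex n} {i : Fin n} (h : order α ≤ 1) (hi : α i ≠ 0) :
    α = Pi.single i 1 := by
  have hsum : order α = α i + ∑ j ∈ Finset.univ.erase i, α j :=
    (Finset.add_sum_erase _ _ (Finset.mem_univ i)).symm
  have hrest : ∑ j ∈ Finset.univ.erase i, α j = 0 := by omega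
  ext j
  by_cases hj : j = i
  · subst hj
    rw [Pi.single_eq_same]
    omega
  · rw [Pi.single_eq_of_ne hj]
    exact Finset.sum_eq_zero_iff.1 hrest j (by simp [hj])

lemma multiIndicesLE_one : multiIndicesLE n 1 =
    insert 0 (Finset.univ.image fun i : Fin n => (Pi.single i 1 : MultiIndex n)) := by
  ext α
  simp only [multiIndicesLE, Finset.mem_filter, Finset.mem_Iic, Finset.mem_insert,
    Finset.mem_image, Finset.mem_univ, true_and]
  constructor
  · rintro ⟨-, h⟩
    refine or_iff_not_imp_left.2 fun h0 => ?_
    obtain ⟨i, hi⟩ := Function.ne_iff.1 h0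
    exact ⟨i, (eq_single_of_order_le_one h hi).symm⟩
  · rintro (rfl | ⟨i, rfl⟩)
    · exact ⟨fun _ => by simp, by simp [order_zero]⟩
    · refine ⟨fun j => ?_, (order_single i).le⟩
      by_cases hj : j = i
      · simp [hj]
      · simp [Pi.single_eq_of_ne hj]

lemma single_mem_multiIndicesLE_one (i : Fin n) :
    (Pi.single i 1 : MultiIndex n) ∈ multiIndicesLE n 1 := by
  simp [multiIndicesLE_one]

lemma sum_multiIndicesLE_one {M : Type*} [AddCommMonoid M] (f : MultiIndex n → M) :
    ∑ α ∈ multiIndicesLE n 1, f α = f 0 + ∑ i : Fin n, f (Pi.single i 1) := by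
  have hinj : Function.Injective fun i : Fin n => (Pi.single i 1 : MultiIndex n) := by
    intro i j h
    by_contra hij
    have hi := congrFun h i
    simp [Pi.single_eq_of_ne hij] at hi
  rw [multiIndicesLE_one, Finset.sum_insert (by simp), Finset.sum_image hinj.injOn]

/-! ### Test functions -/

lemma contDiff_partialDeriv (i : Fin n) {f : E n → ℝ} (hf : ContDiff ℝ ∞ f) :
    ContDiff ℝ ∞ (partialDeriv i f) :=
  (hf.fderiv_right (m := ∞) le_rfl).clm_apply contDiff_const

lemma continuousOn_partialDeriv {U : Set (E n)} (hU : IsOpen U) {f : E n → ℝ}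
    (hf : ContDiffOn ℝ ∞ f U) (i : Fin n) : ContinuousOn (partialDeriv i f) U :=
  (hf.continuousOn_fderiv_of_isOpen hU (by simp)).clm_apply continuousOn_const

lemma tsupport_partialDeriv_subset (i : Fin n) (f : E n → ℝ) :
    tsupport (partialDeriv i f) ⊆ tsupport f :=
  tsupport_fderiv_apply_subset ℝ _

lemma partialDeriv_mul {f g : E n → ℝ} {x : E n} (hf : DifferentiableAt ℝ f x)
    (hg : DifferentiableAt ℝ g x) (i : Fin n) :
    partialDeriv i (f * g) x = f x * partialDeriv i g x + partialDeriv i f x * g x := by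
  simp only [partialDeriv, fderiv_mul hf hg, add_apply, FunLike.coe_smul, Pi.smul_apply,
    smul_eq_mul, mul_comm]

lemma multiDeriv_induction {p : (E n → ℝ) → Prop} (hp : ∀ i f, p f → p (partialDeriv i f))
    (α : MultiIndex n) {f : E n → ℝ} (hf : p f) : p (multiDeriv α f) := by
  unfold multiDeriv
  induction List.finRange n with
  | nil => exact hf
  | cons i l ih => exact Function.Iterate.rec p ih (hp i) (α i)

lemma contDiff_multiDeriv (α : MultiIndex n) {f : E n → ℝ} (hf : ContDiff ℝ ∞ f) :
    ContDiff ℝ ∞ (multiDeriv α f) :=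
  multiDeriv_induction (fun i _ => contDiff_partialDeriv i) α hf

lemma tsupport_multiDeriv_subset (α : MultiIndex n) (f : E n → ℝ) :
    tsupport (multiDeriv α f) ⊆ tsupport f :=
  multiDeriv_induction (p := fun g => tsupport g ⊆ tsupport f)
    (fun i g => (tsupport_partialDeriv_subset i g).trans) α subset_rfl

lemma multiDeriv_zero (f : E n → ℝ) : multiDeriv 0 f = f := by
  unfold multiDeriv
  induction List.finRange n with
  | nil => rfl
  | cons i l _ => simp

lemma multiDeriv_single (i : Fin n) (f : E n → ℝ) :
    multiDeriv (Pi.single i 1) f = partialDeriv i f := by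
  have foldr_eq : ∀ l : List (Fin n), l.Nodup →
      l.foldr (fun j g => (partialDeriv j)^[(Pi.single i 1 : MultiIndex n) j] g) f =
        if i ∈ l then partialDeriv i f else f := by
    intro l hl
    induction l with
    | nil => simp
    | cons j l ih =>
      obtain ⟨hj, hl⟩ := List.nodup_cons.1 hl
      rw [List.foldr_cons, ih hl]
      by_cases h : j = i
      · subst h
        simp [hj]
      · simp [Ne.symm h, h]
  rw [multiDeriv, foldr_eq _ (List.nodup_finRange n), if_pos (List.mem_finRange i)]

lemma contDiff_mul_of_tsupport_subset {U : Set (E n)} (hU : IsOpen U) {ζ φ : E n → ℝ}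
    (hζ : ContDiffOn ℝ ∞ ζ U) (hφ : ContDiff ℝ ∞ φ) (hs : tsupport φ ⊆ U) :
    ContDiff ℝ ∞ (ζ * φ) := by
  refine contDiff_iff_contDiffAt.2 fun x => ?_
  by_cases hx : x ∈ tsupport φ
  · exact (hζ.contDiffAt (hU.mem_nhds (hs hx))).mul hφ.contDiffAt
  · exact (contDiffAt_const (c := (0 : ℝ))).congr_of_eventuallyEq
      ((notMem_tsupport_iff_eventuallyEq.1 hx).mono fun y hy => by simp [hy])

lemma partialDeriv_mul_of_tsupport_subset {U : Set (E n)} (hU : IsOpen U) {ζ φ : E n → ℝ}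
    (hζ : ContDiffOn ℝ ∞ ζ U) (hφ : ContDiff ℝ ∞ φ) (hs : tsupport φ ⊆ U) (i : Fin n) (x : E n) :
    partialDeriv i (ζ * φ) x = ζ x * partialDeriv i φ x + partialDeriv i ζ x * φ x := by
  by_cases hx : x ∈ tsupport φ
  · exact partialDeriv_mul ((hζ.contDiffAt (hU.mem_nhds (hs hx))).differentiableAt (by simp))
      (hφ.differentiable (by simp) x) i
  · have vanish (χ : E n → ℝ) (hχ : tsupport χ ⊆ tsupport φ) : χ x = 0 :=
      image_eq_zero_of_notMem_tsupport fun h => hx (hχ h)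
    rw [vanish φ subset_rfl, vanish _ (tsupport_partialDeriv_subset i φ),
      vanish (partialDeriv i (ζ * φ))
        ((tsupport_partialDeriv_subset i _).trans tsupport_mul_subset_right)]
    ring

lemma integrable_mul_of_tsupport_subset {U : Set (E n)} {f φ : E n → ℝ}
    (hf : LocallyIntegrableOn f U) (hφ : Continuous φ) (hc : HasCompactSupport φ)
    (hs : tsupport φ ⊆ U) : Integrable fun x => f x * φ x := by
  have hon : IntegrableOn (fun x => f x * φ x) (tsupport φ) :=
    (hf.integrableOn_compact_subset hs hc).mul_continuousOn hφ.continuousOn hc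
  exact (integrableOn_iff_integrable_of_support_subset fun x hx =>
    subset_tsupport φ (right_ne_zero_of_mul hx)).1 hon

lemma setIntegral_mul_eq_integral {U : Set (E n)} (f : E n → ℝ) {φ : E n → ℝ}
    (hs : tsupport φ ⊆ U) : ∫ x in U, f x * φ x = ∫ x, f x * φ x :=
  setIntegral_eq_integral_of_forall_compl_eq_zero fun x hx => by
    rw [image_eq_zero_of_notMem_tsupport fun h => hx (hs h), mul_zero]

/-! ### Weak derivatives -/

lemma isWeakDeriv_iff {U : Set (E n)} {α : MultiIndex n} {u g : E n → ℝ} :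
    IsWeakDeriv U α u g ↔ LocallyIntegrableOn u U ∧ LocallyIntegrableOn g U ∧
      ∀ φ : E n → ℝ, ContDiff ℝ ∞ φ → HasCompactSupport φ → tsupport φ ⊆ U →
        ∫ x, u x * multiDeriv α φ x = (-1) ^ order α * ∫ x, g x * φ x := by
  refine ⟨fun h => ⟨h.1, h.2, fun φ hφ hc hs => ?_⟩,
    fun h => ⟨h.1, h.2.1, fun φ hφ hc hs => ?_⟩⟩
  · rw [← setIntegral_mul_eq_integral g hs, ← h.integral_eq φ hφ hc hs,
      setIntegral_mul_eq_integral u ((tsupport_multiDeriv_subset α φ).trans hs)]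
  · rw [setIntegral_mul_eq_integral g hs, ← h.2.2 φ hφ hc hs,
      setIntegral_mul_eq_integral u ((tsupport_multiDeriv_subset α φ).trans hs)]

lemma IsWeakDeriv.mono {U V : Set (E n)} {α : MultiIndex n} {u g : E n → ℝ}
    (h : IsWeakDeriv U α u g) (hVU : V ⊆ U) : IsWeakDeriv V α u g :=
  isWeakDeriv_iff.2 ⟨h.1.mono_set hVU, h.2.mono_set hVU, fun φ hφ hc hs =>
    (isWeakDeriv_iff.1 h).2.2 φ hφ hc (hs.trans hVU)⟩

lemma IsWeakDeriv.sub {U : Set (E n)} {α : MultiIndex n} {u u' g g' : E n → ℝ}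
    (h : IsWeakDeriv U α u g) (h' : IsWeakDeriv U α u' g') :
    IsWeakDeriv U α (u - u') (g - g') := by
  refine isWeakDeriv_iff.2 ⟨h.1.sub h'.1, h.2.sub h'.2, fun φ hφ hc hs => ?_⟩
  have hsα := tsupport_multiDeriv_subset α φ
  have hcα : HasCompactSupport (multiDeriv α φ) := hc.of_isClosed_subset (isClosed_tsupport _) hsα
  have integrable_multiDeriv {f : E n → ℝ} (hf : LocallyIntegrableOn f U) :
      Integrable fun x => f x * multiDeriv α φ x :=
    integrable_mul_of_tsupport_subset hf (contDiff_multiDeriv α hφ).continuous hcα (hsα.trans hs)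
  have integrable_test {f : E n → ℝ} (hf : LocallyIntegrableOn f U) :
      Integrable fun x => f x * φ x :=
    integrable_mul_of_tsupport_subset hf hφ.continuous hc hs
  simp only [Pi.sub_apply, sub_mul]
  rw [integral_sub (integrable_multiDeriv h.1) (integrable_multiDeriv h'.1),
    integral_sub (integrable_test h.2) (integrable_test h'.2),
    (isWeakDeriv_iff.1 h).2.2 φ hφ hc hs, (isWeakDeriv_iff.1 h').2.2 φ hφ hc hs, mul_sub]

lemma IsWeakDeriv.ae_eq_zero {U : Set (E n)} {α : MultiIndex n} {u g : E n → ℝ} (hU : IsOpen U)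
    (h : IsWeakDeriv U α u g) (hu : u =ᵐ[volume.restrict U] 0) : g =ᵐ[volume.restrict U] 0 := by
  have key := hU.ae_eq_zero_of_integral_contDiff_smul_eq_zero (μ := volume) h.2
    fun φ hφ hc hs => ?_
  · exact (ae_restrict_iff' hU.measurableSet).2 key
  · have hzero : ∫ x in U, u x * multiDeriv α φ x = 0 :=
      integral_eq_zero_of_ae (by filter_upwards [hu] with x hx; simp [hx])
    rw [h.integral_eq φ hφ hc hs, setIntegral_mul_eq_integral g hs] at hzero
    simpa [mul_comm] using hzero

lemma IsWeakDeriv.ae_unique {U : Set (E n)} {α : MultiIndex n} {u g g' : E n → ℝ}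
    (hU : IsOpen U) (h : IsWeakDeriv U α u g) (h' : IsWeakDeriv U α u g') :
    g =ᵐ[volume.restrict U] g' :=
  ((h.sub h').ae_eq_zero hU (by rw [sub_self])).mono fun _ => sub_eq_zero.1

lemma isWeakDeriv_zero {U : Set (E n)} {u : E n → ℝ} (hu : LocallyIntegrableOn u U) :
    IsWeakDeriv U 0 u u :=
  ⟨hu, hu, fun φ _ _ _ => by simp [multiDeriv_zero, order_zero]⟩

lemma HasWeakDeriv.isWeakDeriv {U : Set (E n)} {α : MultiIndex n} {u : E n → ℝ}
    (h : HasWeakDeriv U α u) : IsWeakDeriv U α u (weakDeriv U α u) := by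
  rw [weakDeriv, dif_pos h]
  exact h.choose_spec

lemma IsWeakDeriv.weakDeriv_ae_eq {U : Set (E n)} {α : MultiIndex n} {u g : E n → ℝ}
    (hU : IsOpen U) (h : IsWeakDeriv U α u g) : weakDeriv U α u =ᵐ[volume.restrict U] g :=
  (HasWeakDeriv.isWeakDeriv ⟨g, h⟩).ae_unique hU h

lemma isWeakDeriv_single_const (U : Set (E n)) (i : Fin n) (c : ℝ) :
    IsWeakDeriv U (Pi.single i 1) (fun _ => c) 0 := by
  refine isWeakDeriv_iff.2 ⟨(locallyIntegrable_const c).locallyIntegrableOn _,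
    locallyIntegrable_zero.locallyIntegrableOn _, fun φ hφ hc _ => ?_⟩
  have hφ' : Integrable fun x => fderiv ℝ φ x (EuclideanSpace.single i (1 : ℝ)) :=
    (contDiff_partialDeriv i hφ).continuous.integrable_of_hasCompactSupport (hc.fderiv_apply ℝ _)
  have := integral_mul_fderiv_eq_neg_fderiv_mul_of_integrable (f := fun _ => (1 : ℝ))
    (g := φ) (v := EuclideanSpace.single i 1) (μ := volume) (by simp) (by simpa using hφ')
    (by simpa using hφ.continuous.integrable_of_hasCompactSupport hc)
    (fun x _ => differentiableAt_const _) (fun x _ => hφ.differentiable (by simp) x)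
  rw [multiDeriv_single, integral_const_mul]
  simpa [partialDeriv] using Or.inr this

/-- The gradient of the product `ζ u` according to the Leibniz rule, where `g` is the gradient
of `u`. -/
noncomputable def mulGrad (ζ u : E n → ℝ) (g : Fin n → E n → ℝ) (i : Fin n) : E n → ℝ :=
  ζ * g i + partialDeriv i ζ * u

/-- A test function `φ` on `U` yields the test function `ζ φ` on the smaller set `U₀`; there is no
contribution from `∂U₀`, because `ζ` vanishes near `∂U₀ ∩ U`. -/
lemma IsWeakDeriv.mul_smooth {U₀ U : Set (E n)} (hU : IsOpen U) {i : Fin n} {u ζ : E n → ℝ}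
    {g : Fin n → E n → ℝ} (h : IsWeakDeriv U₀ (Pi.single i 1) u (g i))
    (hζ : ContDiffOn ℝ ∞ ζ U) (hsupp : tsupport ζ ∩ U ⊆ U₀)
    (hζu : LocallyIntegrableOn (ζ * u) U) (hgrad : LocallyIntegrableOn (mulGrad ζ u g i) U) :
    IsWeakDeriv U (Pi.single i 1) (ζ * u) (mulGrad ζ u g i) := by
  refine isWeakDeriv_iff.2 ⟨hζu, hgrad, fun φ hφ hc hs => ?_⟩
  have hs' : tsupport (partialDeriv i φ) ⊆ U := (tsupport_partialDeriv_subset i φ).trans hs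
  have hψ := contDiff_mul_of_tsupport_subset hU hζ hφ hs
  have hθ := contDiff_mul_of_tsupport_subset hU hζ (contDiff_partialDeriv i hφ) hs'
  have supp_subset {χ : E n → ℝ} (hχ : tsupport χ ⊆ U) : tsupport (ζ * χ) ⊆ U₀ := fun x hx =>
    hsupp ⟨tsupport_mul_subset_left hx, hχ (tsupport_mul_subset_right hx)⟩
  have hψc : HasCompactSupport (ζ * φ) := hc.mul_left
  have hθc : HasCompactSupport (ζ * partialDeriv i φ) := HasCompactSupport.mul_left
    (hc.fderiv_apply ℝ _)
  have weak := (isWeakDeriv_iff.1 h).2.2 _ hψ hψc (supp_subset hs)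
  rw [multiDeriv_single, order_single] at weak ⊢
  have hiψ := integrable_mul_of_tsupport_subset h.2 hψ.continuous hψc (supp_subset hs)
  have hiDψ := integrable_mul_of_tsupport_subset h.1 (contDiff_partialDeriv i hψ).continuous
    (hψc.fderiv_apply ℝ _) ((tsupport_partialDeriv_subset i _).trans (supp_subset hs))
  have hiθ := integrable_mul_of_tsupport_subset h.1 hθ.continuous hθc (supp_subset hs')
  have hiDψ_sub : Integrable fun x => u x * partialDeriv i (ζ * φ) x -
      u x * (ζ * partialDeriv i φ) x := hiDψ.sub hiθ
  have expand (x : E n) : mulGrad ζ u g i x * φ x = g i x * (ζ * φ) x +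
      (u x * partialDeriv i (ζ * φ) x - u x * (ζ * partialDeriv i φ) x) := by
    rw [partialDeriv_mul_of_tsupport_subset hU hζ hφ hs]
    simp only [mulGrad, Pi.add_apply, Pi.mul_apply]
    ring
  simp only [expand]
  rw [integral_add hiψ hiDψ_sub, integral_sub hiDψ hiθ, weak]
  have hassoc (x : E n) : (ζ * u) x * partialDeriv i φ x = u x * (ζ * partialDeriv i φ) x := by
    simp only [Pi.mul_apply]
    ring
  simp only [hassoc]
  ring

/-! ### The norms of `L²` and `H¹` -/

lemma derivNorm_mono {U D : Set (E n)} {s t : Finset (MultiIndex n)} (h : s ⊆ t) (p : ℝ≥0∞)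
    (u : E n → ℝ) : derivNorm U D s p u ≤ derivNorm U D t p u := by
  unfold derivNorm
  by_cases ht : ∀ α ∈ t, HasWeakDeriv U α u
  · rw [if_pos ht, if_pos fun α hα => ht α (h hα)]
    split_ifs with hp
    · exact Finset.sup_mono h
    · gcongr
  · rw [if_neg ht]
    exact le_top

lemma gradNorm_le_sobolevNorm (U : Set (E n)) (u : E n → ℝ) :
    gradNorm U u ≤ sobolevNorm U 1 2 u :=
  derivNorm_mono (by rw [multiIndicesLE_one]; exact Finset.subset_insert _ _) 2 u

lemma locallyIntegrableOn_of_memLp_two {U : Set (E n)} {u : E n → ℝ}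
    (h : MemLp u 2 (volume.restrict U)) : LocallyIntegrableOn u U :=
  locallyIntegrableOn_of_locallyIntegrable_restrict (h.locallyIntegrable one_le_two)

lemma l2Norm_eq {D : Set (E n)} {u : E n → ℝ} (h : MemLp u 2 (volume.restrict D)) :
    l2Norm D u = ENNReal.ofReal (√(∫ x in D, u x ^ 2)) := by
  rw [l2Norm, h.eLpNorm_eq_integral_rpow_norm two_ne_zero ENNReal.ofNat_ne_top,
    Real.sqrt_eq_rpow]
  simp

lemma l2Norm_rpow_two (D : Set (E n)) (u : E n → ℝ) :
    l2Norm D u ^ (2 : ℝ) = ∫⁻ x in D, ENNReal.ofReal (u x ^ 2) := by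
  have h := eLpNorm_nnreal_pow_eq_lintegral (f := u) (μ := volume.restrict D) (p := 2) two_ne_zero
  simp only [NNReal.coe_ofNat, ENNReal.coe_ofNat] at h
  rw [l2Norm, h]
  refine lintegral_congr fun x => ?_
  rw [Real.enorm_eq_ofReal_abs, ENNReal.ofReal_rpow_of_nonneg (abs_nonneg _) zero_le_two,
    Real.rpow_two, sq_abs]

lemma derivNorm_two {U D : Set (E n)} {s : Finset (MultiIndex n)} {u : E n → ℝ}
    (h : ∀ α ∈ s, HasWeakDeriv U α u) :
    derivNorm U D s 2 u = (∑ α ∈ s, l2Norm D (weakDeriv U α u) ^ (2 : ℝ)) ^ (2⁻¹ : ℝ) := by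
  simp [derivNorm, if_pos h, l2Norm]

lemma sobolevNorm_zero_two {U : Set (E n)} (hU : IsOpen U) {u : E n → ℝ}
    (h : LocallyIntegrableOn u U) : sobolevNorm U 0 2 u = l2Norm U u := by
  have hw := isWeakDeriv_zero h
  rw [sobolevNorm, multiIndicesLE_zero,
    derivNorm_two fun α hα => by rw [Finset.mem_singleton.1 hα]; exact ⟨u, hw⟩,
    Finset.sum_singleton, ENNReal.rpow_rpow_inv two_ne_zero]
  exact eLpNorm_congr_ae (hw.weakDeriv_ae_eq hU)

/-- `u` belongs to `H¹(U)` and `g` is its weak gradient. -/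
structure HasH1Gradient (U : Set (E n)) (u : E n → ℝ) (g : Fin n → E n → ℝ) : Prop where
  memLp : MemLp u 2 (volume.restrict U)
  memLp_deriv : ∀ i, MemLp (g i) 2 (volume.restrict U)
  weak : ∀ i, IsWeakDeriv U (Pi.single i 1) u (g i)

/-- The density `u² + |g|²` of the squared `H¹` norm of a function `u` with gradient `g`. -/
def energy (u : E n → ℝ) (g : Fin n → E n → ℝ) (x : E n) : ℝ := u x ^ 2 + ∑ i, g i x ^ 2

lemma energy_nonneg (u : E n → ℝ) (g : Fin n → E n → ℝ) (x : E n) : 0 ≤ energy u g x :=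
  add_nonneg (sq_nonneg _) (Finset.sum_nonneg fun _ _ => sq_nonneg _)

lemma lintegral_energy {D : Set (E n)} (u : E n → ℝ) {g : Fin n → E n → ℝ}
    (hg : ∀ i, AEMeasurable (g i) (volume.restrict D)) :
    ∫⁻ x in D, ENNReal.ofReal (energy u g x) =
      l2Norm D u ^ (2 : ℝ) + ∑ i, l2Norm D (g i) ^ (2 : ℝ) := by
  have hsq (i : Fin n) : AEMeasurable (fun x => ENNReal.ofReal (g i x ^ 2)) (volume.restrict D) :=
    ((hg i).pow_const 2).ennreal_ofReal
  simp only [l2Norm_rpow_two]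
  rw [← lintegral_finsetSum' _ fun i _ => hsq i,
    ← lintegral_add_right' _ (Finset.aemeasurable_fun_sum _ fun i _ => hsq i)]
  refine lintegral_congr fun x => ?_
  rw [energy, ENNReal.ofReal_add (sq_nonneg _) (Finset.sum_nonneg fun _ _ => sq_nonneg _),
    ENNReal.ofReal_sum_of_nonneg fun _ _ => sq_nonneg _]

namespace HasH1Gradient

variable {U V D : Set (E n)} {u v : E n → ℝ} {g k : Fin n → E n → ℝ}

lemma mono (h : HasH1Gradient U u g) (hV : V ⊆ U) : HasH1Gradient V u g :=
  ⟨h.1.mono_measure (Measure.restrict_mono hV le_rfl),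
    fun i => (h.2 i).mono_measure (Measure.restrict_mono hV le_rfl),
    fun i => (h.3 i).mono hV⟩

lemma sub (h : HasH1Gradient U u g) (h' : HasH1Gradient U v k) :
    HasH1Gradient U (u - v) (g - k) :=
  ⟨h.1.sub h'.1, fun i => (h.2 i).sub (h'.2 i), fun i => (h.3 i).sub (h'.3 i)⟩

lemma gradient_ae_eq_zero (h : HasH1Gradient U u g) (hU : IsOpen U)
    (hu : u =ᵐ[volume.restrict U] 0) : ∀ᵐ x ∂volume.restrict U, ∀ i, g i x = 0 :=
  ae_all_iff.2 fun i => (h.3 i).ae_eq_zero hU hu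

lemma weakPartial_ae_eq (h : HasH1Gradient U u g) (hU : IsOpen U) :
    ∀ᵐ x ∂volume.restrict U, ∀ i, weakPartial U i u x = g i x :=
  ae_all_iff.2 fun i => (h.3 i).weakDeriv_ae_eq hU

lemma integrable_energy (h : HasH1Gradient U u g) : IntegrableOn (energy u g) U :=
  h.1.integrable_sq.add (integrable_finsetSum _ fun i _ => (h.2 i).integrable_sq)

lemma h1NormOn_eq (h : HasH1Gradient U u g) (hU : IsOpen U) (hD : D ⊆ U) :
    h1NormOn U D u = (∫⁻ x in D, ENNReal.ofReal (energy u g x)) ^ (2⁻¹ : ℝ) := by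
  have h0 := isWeakDeriv_zero (locallyIntegrableOn_of_memLp_two h.1)
  have hw : ∀ α ∈ multiIndicesLE n 1, HasWeakDeriv U α u := by
    intro α hα
    rw [multiIndicesLE_one, Finset.mem_insert, Finset.mem_image] at hα
    obtain rfl | ⟨i, -, rfl⟩ := hα
    exacts [⟨u, h0⟩, ⟨g i, h.3 i⟩]
  have l2Norm_eq {α : MultiIndex n} {f : E n → ℝ} (hf : IsWeakDeriv U α u f) :
      l2Norm D (weakDeriv U α u) = l2Norm D f :=
    eLpNorm_congr_ae (ae_restrict_of_ae_restrict_of_subset hD (hf.weakDeriv_ae_eq hU))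
  rw [h1NormOn, derivNorm_two hw, sum_multiIndicesLE_one, l2Norm_eq h0,
    lintegral_energy u fun i => ((h.mono hD).memLp_deriv i).aemeasurable]
  simp only [l2Norm_eq (h.3 _)]

lemma sobolevNorm_eq (h : HasH1Gradient U u g) (hU : IsOpen U) :
    sobolevNorm U 1 2 u = ENNReal.ofReal (√(∫ x in U, energy u g x)) := by
  have hE : 0 ≤ᵐ[volume.restrict U] energy u g := ae_of_all _ (energy_nonneg u g)
  rw [Real.sqrt_eq_rpow, one_div, ← ENNReal.ofReal_rpow_of_nonneg (integral_nonneg_of_ae hE)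
    (by norm_num), ofReal_integral_eq_lintegral_ofReal h.integrable_energy hE]
  exact h.h1NormOn_eq hU subset_rfl

lemma mem_H1 (h : HasH1Gradient U u g) (hU : IsOpen U) : u ∈ H1 U :=
  (h.sobolevNorm_eq hU).trans_lt ENNReal.ofReal_lt_top

end HasH1Gradient

lemma hasH1Gradient_of_mem_H1 {U : Set (E n)} (hU : IsOpen U) {u : E n → ℝ} (h : u ∈ H1 U) :
    HasH1Gradient U u fun i => weakPartial U i u := by
  have hlt : derivNorm U U (multiIndicesLE n 1) 2 u < ⊤ := h
  have hw : ∀ α ∈ multiIndicesLE n 1, HasWeakDeriv U α u := by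
    by_contra hw
    rw [derivNorm, if_neg hw] at hlt
    exact lt_irrefl _ hlt
  rw [derivNorm_two hw, ENNReal.rpow_lt_top_iff_of_pos (by norm_num), ENNReal.sum_lt_top] at hlt
  have memLp {α : MultiIndex n} (hα : α ∈ multiIndicesLE n 1) :
      MemLp (weakDeriv U α u) 2 (volume.restrict U) :=
    ⟨(hw α hα).isWeakDeriv.locallyIntegrable_deriv.aestronglyMeasurable,
      (ENNReal.rpow_lt_top_iff_of_pos zero_lt_two).1 (hlt α hα)⟩
  have h0 : (0 : MultiIndex n) ∈ multiIndicesLE n 1 := by simp [multiIndicesLE_one]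
  have hu := (isWeakDeriv_zero (hw 0 h0).isWeakDeriv.locallyIntegrable).weakDeriv_ae_eq hU
  exact ⟨(memLp_congr_ae hu).1 (memLp h0), fun i => memLp (single_mem_multiIndicesLE_one i),
    fun i => (hw _ (single_mem_multiIndicesLE_one i)).isWeakDeriv⟩

lemma memLp_mul_of_support_subset {U₀ U : Set (E n)} (hU₀ : MeasurableSet U₀)
    (hU : MeasurableSet U) {a f : E n → ℝ} {M : ℝ} (ha : ContinuousOn a U)
    (hM : ∀ x ∈ U, |a x| ≤ M) (hsupp : Function.support a ∩ U ⊆ U₀)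
    (hf : MemLp f 2 (volume.restrict U₀)) : MemLp (a * f) 2 (volume.restrict U) := by
  have hind : MemLp (U₀.indicator f) 2 (volume.restrict U) :=
    ((memLp_indicator_iff_restrict hU₀).2 hf).restrict U
  have hmul : MemLp (a * U₀.indicator f) 2 (volume.restrict U) := by
    refine hind.of_le_mul (c := M)
      ((ha.aestronglyMeasurable hU).mul hind.aestronglyMeasurable) ?_
    filter_upwards [ae_restrict_mem hU] with x hx
    rw [Pi.mul_apply, norm_mul]
    exact mul_le_mul_of_nonneg_right (hM x hx) (norm_nonneg _)
  refine (memLp_congr_ae ?_).1 hmul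
  filter_upwards [ae_restrict_mem hU] with x hx
  by_cases hx₀ : x ∈ U₀
  · simp [indicator_of_mem hx₀]
  · have : a x = 0 := by_contra fun h => hx₀ (hsupp ⟨h, hx⟩)
    simp [this]

lemma HasH1Gradient.mul_smooth {U₀ U : Set (E n)} (hU₀ : IsOpen U₀) (hU : IsOpen U)
    {u ζ : E n → ℝ} {g : Fin n → E n → ℝ} (h : HasH1Gradient U₀ u g)
    (hζ : ContDiffOn ℝ ∞ ζ U) {M M' : ℝ} (hM : ∀ x ∈ U, |ζ x| ≤ M)
    (hM' : ∀ x ∈ U, ∀ i, |partialDeriv i ζ x| ≤ M') (hsupp : tsupport ζ ∩ U ⊆ U₀) :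
    HasH1Gradient U (ζ * u) (mulGrad ζ u g) := by
  have memLp_mul {f : E n → ℝ} (hf : MemLp f 2 (volume.restrict U₀)) :
      MemLp (ζ * f) 2 (volume.restrict U) :=
    memLp_mul_of_support_subset hU₀.measurableSet hU.measurableSet hζ.continuousOn hM
      ((inter_subset_inter_left U (subset_tsupport ζ)).trans hsupp) hf
  have memLp_grad (i : Fin n) : MemLp (mulGrad ζ u g i) 2 (volume.restrict U) :=
    (memLp_mul (h.2 i)).add <|
      memLp_mul_of_support_subset hU₀.measurableSet hU.measurableSet
        (continuousOn_partialDeriv hU hζ i) (fun x hx => hM' x hx i)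
        ((inter_subset_inter_left U ((subset_tsupport _).trans
          (tsupport_partialDeriv_subset i ζ))).trans hsupp) h.1
  exact ⟨memLp_mul h.1, memLp_grad, fun i => (h.3 i).mul_smooth hU hζ hsupp
    (locallyIntegrableOn_of_memLp_two (memLp_mul h.1))
    (locallyIntegrableOn_of_memLp_two (memLp_grad i))⟩

lemma hasH1Gradient_const {U : Set (E n)} (hU : volume U ≠ ⊤) (c : ℝ) :
    HasH1Gradient U (fun _ => c) 0 :=
  have : IsFiniteMeasure (volume.restrict U) := isFiniteMeasure_restrict.2 hU
  ⟨memLp_const c, fun _ => MemLp.zero', fun i => isWeakDeriv_single_const U i c⟩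

/-! ### Sets without frontier in a region -/

lemma isOpen_inter_of_disjoint_frontier {X : Type*} [TopologicalSpace X] {O G : Set X}
    (hO : IsOpen O) (h : Disjoint O (frontier G)) : IsOpen (O ∩ G) := by
  have : O ∩ G = O ∩ interior G := by
    refine Subset.antisymm (fun x hx => ⟨hx.1, ?_⟩) (inter_subset_inter_right O interior_subset)
    by_contra hxG
    exact disjoint_left.1 h hx.1 ⟨subset_closure hx.2, hxG⟩
  exact this ▸ hO.inter isOpen_interior

lemma subset_of_isPreconnected_of_disjoint_frontier {X : Type*} [TopologicalSpace X] {T G : Set X}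
    (hT : IsPreconnected T) (h : Disjoint T (frontier G)) (hTG : (T ∩ G).Nonempty) : T ⊆ G := by
  have hcover : T ⊆ interior G ∪ interior Gᶜ := by
    rw [← compl_frontier_eq_union_interior]
    exact h.subset_compl_right
  obtain ⟨x, hxT, hxG⟩ := hTG
  have hx : x ∈ interior G := (hcover hxT).resolve_right fun hx => interior_subset hx hxG
  exact (hT.subset_left_of_subset_union isOpen_interior isOpen_interior
    (disjoint_compl_right.mono interior_subset interior_subset) hcover
    ⟨x, hxT, hx⟩).trans interior_subset

lemma disjoint_ball_inter_frontier {Ω G : Set (E n)} (hΩ : IsOpen Ω) {z : E n} {d : ℝ}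
    (hz : ENNReal.ofReal d ≤ Metric.infEDist z (frontier G \ frontier Ω)) :
    Disjoint (Metric.ball z d ∩ Ω) (frontier G) := by
  refine disjoint_left.2 fun y hy hyG => ?_
  have hyΩ : y ∉ frontier Ω := disjoint_right.1 (disjoint_frontier_iff_isOpen.2 hΩ) hy.2
  have hd := hz.trans (Metric.infEDist_le_edist_of_mem (⟨hyG, hyΩ⟩ : y ∈ frontier G \ frontier Ω))
  rw [edist_dist, ENNReal.ofReal_le_ofReal_iff dist_nonneg, dist_comm] at hd
  exact (Metric.mem_ball.1 hy.1).not_ge hd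

lemma isOpen_ball_inter {Ω G : Set (E n)} (hΩ : IsOpen Ω) (hG : G ⊆ Ω) {z : E n} {r : ℝ}
    (h : Disjoint (Metric.ball z r ∩ Ω) (frontier G)) : IsOpen (Metric.ball z r ∩ G) := by
  rw [← inter_eq_right.2 hG, ← inter_assoc]
  exact isOpen_inter_of_disjoint_frontier (Metric.isOpen_ball.inter hΩ) h

lemma le_dist_of_mem_frontier {Ω G : Set (E n)} (hΩ : IsOpen Ω) (hG : G ⊆ Ω) {z y : E n} {r : ℝ}
    (h : Disjoint (Metric.ball z r ∩ Ω) (frontier G))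
    (hy : y ∈ frontier (Metric.ball z r ∩ G) \ frontier Ω) : r ≤ dist y z := by
  obtain ⟨hy, hyΩ⟩ := hy
  by_contra! hlt
  rcases frontier_inter_subset _ _ hy with hball | hfr
  · exact hlt.ne (Metric.frontier_ball_subset_sphere hball.1)
  · have hyΩ' : y ∈ Ω := by
      by_contra hyΩ'
      rw [hΩ.frontier_eq] at hyΩ
      exact hyΩ ⟨closure_mono hG (frontier_subset_closure hfr.2), hyΩ'⟩
    exact disjoint_left.1 h ⟨hlt, hyΩ'⟩ hfr.2

lemma subset_ball_inter_of_diam_le {Ω G T : Set (E n)} {z : E n} {ρ r : ℝ}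
    (h : Disjoint (Metric.ball z r ∩ Ω) (frontier G)) (hT : IsPreconnected T)
    (hTb : Bornology.IsBounded T) (hTΩ : T ⊆ Ω) (hmeet : (T ∩ (Metric.ball z ρ ∩ G)).Nonempty)
    (hd : ρ + Metric.diam T ≤ r) : T ⊆ Metric.ball z r ∩ G := by
  obtain ⟨x, hxT, hxb, hxG⟩ := hmeet
  have hball : T ⊆ Metric.ball z r := fun y hy => by
    have hyx := Metric.dist_le_diam_of_mem hTb hy hxT
    have hxz := Metric.mem_ball.1 hxb
    exact Metric.mem_ball.2 (by linarith [dist_triangle y x z])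
  exact subset_inter hball (subset_of_isPreconnected_of_disjoint_frontier hT
    (h.mono_left (subset_inter hball hTΩ)) ⟨x, hxT, hxG⟩)

/-- Were the distance larger than `δ`, the set would be relatively closed in `Ω`. -/
lemma setDist_eq_of_isPreconnected {Ω V : Set (E n)} (hΩ : IsOpen Ω) (hΩc : IsPreconnected Ω)
    (hV : IsOpen V) (hVΩ : V ⊂ Ω) {δ : ℝ≥0∞}
    (hne : (V ∩ {x | δ < Metric.infEDist x (frontier V \ frontier Ω)}).Nonempty) :
    setDist (V ∩ {x | δ < Metric.infEDist x (frontier V \ frontier Ω)})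
      (frontier V \ frontier Ω) = δ := by
  set F := frontier V \ frontier Ω
  set A := V ∩ {x | δ < Metric.infEDist x F}
  refine le_antisymm ?_ (le_iInf₂ fun x hx => hx.2.le)
  by_contra! hlt
  have hA : IsOpen A := hV.inter (isOpen_lt continuous_const Metric.continuous_infEDist)
  have lt_infEDist {x : E n} (hx : x ∈ closure A) : δ < Metric.infEDist x F := by
    have hsub : A ⊆ {x | setDist A F ≤ Metric.infEDist x F} := fun y hy =>
      (iInf₂_le y hy : ⨅ x ∈ A, Metric.infEDist x F ≤ Metric.infEDist y F)
    exact hlt.trans_le (closure_minimal hsub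
      (isClosed_le continuous_const Metric.continuous_infEDist) hx)
  have hcl : closure A ∩ Ω ⊆ A := by
    rintro x ⟨hx, hxΩ⟩
    refine ⟨by_contra fun hxV => ?_, lt_infEDist hx⟩
    have hxF : x ∈ F := by
      refine ⟨?_, disjoint_right.1 (disjoint_frontier_iff_isOpen.2 hΩ) hxΩ⟩
      rw [hV.frontier_eq]
      exact ⟨closure_mono inter_subset_left hx, hxV⟩
    exact not_lt_zero (Metric.infEDist_zero_of_mem hxF ▸ lt_infEDist hx)
  obtain ⟨x, hx⟩ := hne
  have hΩA := hΩc.subset_of_closure_inter_subset hA ⟨x, hVΩ.1 hx.1, hx⟩ hcl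
  exact hVΩ.2 (hΩA.trans inter_subset_left)

lemma neZero_of_ssubset {G Ω : Set (E n)} (hne : G.Nonempty) (h : G ⊂ Ω) : NeZero n := by
  refine ⟨fun hn => ?_⟩
  subst hn
  exact h.2 (Subsingleton.eq_univ_of_nonempty hne ▸ subset_univ Ω)

/-! ### Cutoff functions -/

/-- `ζ` is a cutoff function on the scale `d`: it is smooth in `Ω`, equal to one on `V`, supported
in `W` within `Ω`, and its derivatives up to the order `r` are bounded by the powers of `d`. -/
structure IsCutoff (r : ℕ) (K d : ℝ) (Ω V W : Set (E n)) (ζ : E n → ℝ) : Prop where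
  contDiffOn : ContDiffOn ℝ ∞ ζ Ω
  nonneg : ∀ x, 0 ≤ ζ x
  le_one : ∀ x, ζ x ≤ 1
  eq_one : ∀ x ∈ V, ζ x = 1
  tsupport_inter_subset : tsupport ζ ∩ Ω ⊆ W
  norm_iteratedFDeriv_le : ∀ j ≤ r, ∀ x ∈ Ω, ‖iteratedFDeriv ℝ j ζ x‖ ≤ K / d ^ j

lemma exists_norm_iteratedFDeriv_le {ψ : E n → ℝ} (hψ : ContDiff ℝ ∞ ψ)
    (hc : HasCompactSupport ψ) (r : ℕ) :
    ∃ K : ℝ, 0 < K ∧ ∀ j ≤ r, ∀ x, ‖iteratedFDeriv ℝ j ψ x‖ ≤ K := by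
  have hbound (j : ℕ) : ∃ K : ℝ, ∀ x, ‖iteratedFDeriv ℝ j ψ x‖ ≤ K :=
    (hc.iteratedFDeriv j).exists_bound_of_continuous
      (hψ.continuous_iteratedFDeriv (by exact_mod_cast le_top))
  choose K hK using hbound
  have hK0 (j : ℕ) : 0 ≤ K j := (norm_nonneg _).trans (hK j 0)
  refine ⟨1 + ∑ j ∈ Finset.range (r + 1), K j,
    add_pos_of_pos_of_nonneg one_pos (Finset.sum_nonneg fun j _ => hK0 j), fun j hj x => ?_⟩
  calc ‖iteratedFDeriv ℝ j ψ x‖ ≤ K j := hK j x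
    _ ≤ ∑ j ∈ Finset.range (r + 1), K j :=
        Finset.single_le_sum (fun j _ => hK0 j) (Finset.mem_range.2 (Nat.lt_succ_of_le hj))
    _ ≤ _ := (lt_one_add _).le

lemma exists_isCutoff_ball (n r : ℕ) : ∃ K : ℝ, 0 < K ∧
    ∀ (z : E n) (d : ℝ), 0 < d → ∀ Ω : Set (E n),
      ∃ η, IsCutoff r K d Ω (Metric.ball z (d / 8)) (Metric.ball z (d / 4)) η := by
  let φ : ContDiffBump (0 : E n) := ⟨1 / 8, 3 / 16, by norm_num, by norm_num⟩
  obtain ⟨K, hK0, hK⟩ := exists_norm_iteratedFDeriv_le φ.contDiff φ.hasCompactSupport r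
  obtain ⟨ψ, hψφ⟩ : ∃ ψ : E n → ℝ, ψ = φ := ⟨φ, rfl⟩
  rw [← hψφ] at hK
  have hψ : ContDiff ℝ ∞ ψ := hψφ ▸ φ.contDiff
  refine ⟨K, hK0, fun z d hd Ω => ?_⟩
  have hnorm (x : E n) : ‖d⁻¹ • (x - z)‖ = dist x z / d := by
    rw [norm_smul, norm_inv, Real.norm_of_nonneg hd.le, dist_eq_norm, inv_mul_eq_div]
  have hscale : ContDiff ℝ ∞ fun x : E n => d⁻¹ • (x - z) :=
    (contDiff_id.sub contDiff_const).const_smul d⁻¹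
  have hsub : tsupport (fun x => ψ (d⁻¹ • (x - z))) ⊆ Metric.closedBall z (3 / 16 * d) := by
    refine closure_minimal (fun x hx => ?_) Metric.isClosed_closedBall
    have hx' : d⁻¹ • (x - z) ∈ Function.support φ := hψφ ▸ hx
    rw [φ.support_eq, mem_ball_zero_iff, hnorm, div_lt_iff₀ hd] at hx'
    exact Metric.mem_closedBall.2 hx'.le
  refine ⟨fun x => ψ (d⁻¹ • (x - z)), (hψ.comp hscale).contDiffOn, fun x => hψφ ▸ φ.nonneg,
    fun x => hψφ ▸ φ.le_one, fun x hx => ?_, ?_, fun j hj x _ => ?_⟩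
  · rw [hψφ]
    refine φ.one_of_mem_closedBall ?_
    rw [mem_closedBall_zero_iff, hnorm, div_le_iff₀ hd, one_div_mul_eq_div]
    exact (Metric.mem_ball.1 hx).le
  · exact inter_subset_left.trans (hsub.trans (Metric.closedBall_subset_ball (by linarith)))
  · rw [iteratedFDeriv_comp_sub (f := fun y => ψ (d⁻¹ • y)),
      iteratedFDeriv_comp_const_smul d⁻¹ (hψ.of_le (by exact_mod_cast le_top)), norm_smul,
      norm_pow, norm_inv, Real.norm_of_nonneg hd.le, inv_pow, inv_mul_eq_div]
    gcongr
    exact hK j hj _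

lemma eventuallyEq_indicator_or_eventuallyEq_zero {G : Set (E n)} {η : E n → ℝ} {x : E n}
    (h : x ∈ tsupport η → x ∉ frontier G) :
    (x ∈ G ∧ x ∈ tsupport η ∧ G.indicator η =ᶠ[𝓝 x] η) ∨ G.indicator η =ᶠ[𝓝 x] fun _ => 0 := by
  by_cases hx : x ∈ tsupport η
  · have hxG : x ∈ interior G ∪ interior Gᶜ := by
      rw [← compl_frontier_eq_union_interior]
      exact h hx
    rcases hxG with hxG | hxG <;> have hnhds := mem_interior_iff_mem_nhds.1 hxG
    · exact .inl ⟨mem_of_mem_nhds hnhds, hx,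
        eventually_of_mem hnhds fun y hy => indicator_of_mem hy η⟩
    · exact .inr (eventually_of_mem hnhds fun y hy => indicator_of_notMem hy η)
  · refine .inr ((notMem_tsupport_iff_eventuallyEq.1 hx).mono fun y hy => ?_)
    by_cases hyG : y ∈ G <;> simp [hyG, hy]

namespace IsCutoff

variable {r : ℕ} {K d : ℝ} {Ω V W : Set (E n)} {ζ : E n → ℝ}

lemma indicator (h : IsCutoff r K d Ω V W ζ) {G : Set (E n)}
    (hG : Disjoint (W ∩ Ω) (frontier G)) :
    IsCutoff r K d Ω (V ∩ G) (W ∩ G) (G.indicator ζ) := by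
  have hloc {x : E n} (hx : x ∈ Ω) := eventuallyEq_indicator_or_eventuallyEq_zero
    fun hxζ : x ∈ tsupport ζ => disjoint_left.1 hG ⟨h.tsupport_inter_subset ⟨hxζ, hx⟩, hx⟩
  refine ⟨fun x hx => ?_, indicator_nonneg fun x _ => h.nonneg x,
    fun x => (indicator_le_self' (fun x _ => h.nonneg x) x).trans (h.le_one x),
    fun x hx => by rw [indicator_of_mem hx.2, h.eq_one x hx.1], fun x hx => ?_,
    fun j hj x hx => ?_⟩
  · rcases hloc hx with ⟨-, -, heq⟩ | heq
    · exact (h.contDiffOn x hx).congr_of_eventuallyEq (heq.filter_mono nhdsWithin_le_nhds)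
        heq.eq_of_nhds
    · exact (contDiffAt_const.congr_of_eventuallyEq heq).contDiffWithinAt
  · rcases hloc hx.2 with ⟨hxG, hxζ, -⟩ | heq
    · exact ⟨h.tsupport_inter_subset ⟨hxζ, hx.2⟩, hxG⟩
    · exact absurd hx.1 (notMem_tsupport_iff_eventuallyEq.2 heq)
  · have hle := h.norm_iteratedFDeriv_le j hj x hx
    rcases hloc hx with ⟨-, -, heq⟩ | heq
    · rwa [(heq.iteratedFDeriv ℝ j).eq_of_nhds]
    · rw [(heq.iteratedFDeriv ℝ j).eq_of_nhds, iteratedFDeriv_fun_zero, Pi.zero_apply, norm_zero]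
      exact (norm_nonneg _).trans hle

lemma abs_le_one (h : IsCutoff r K d Ω V W ζ) (x : E n) : |ζ x| ≤ 1 :=
  (abs_of_nonneg (h.nonneg x)).trans_le (h.le_one x)

lemma abs_partialDeriv_le (h : IsCutoff r K d Ω V W ζ) (hr : 1 ≤ r) {x : E n} (hx : x ∈ Ω)
    (i : Fin n) : |partialDeriv i ζ x| ≤ K / d := by
  have hle := h.norm_iteratedFDeriv_le 1 hr x hx
  rw [norm_iteratedFDeriv_one, pow_one] at hle
  calc |partialDeriv i ζ x|
      ≤ ‖fderiv ℝ ζ x‖ * ‖(EuclideanSpace.single i (1 : ℝ) : E n)‖ :=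
        (fderiv ℝ ζ x).le_opNorm _
    _ ≤ K / d := by simpa using hle

lemma energy_mul_eq (h : IsCutoff r K d Ω V W ζ) (hV : IsOpen V) (u : E n → ℝ)
    (g : Fin n → E n → ℝ) {x : E n} (hx : x ∈ V) :
    energy (ζ * u) (mulGrad ζ u g) x = energy u g x := by
  have heq : ζ =ᶠ[𝓝 x] fun _ => 1 := eventually_of_mem (hV.mem_nhds hx) h.eq_one
  simp [energy, mulGrad, partialDeriv, heq.fderiv_eq, h.eq_one x hx]

lemma eq_zero (h : IsCutoff r K d Ω V W ζ) {x : E n} (hx : x ∈ Ω \ W) : ζ x = 0 :=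
  image_eq_zero_of_notMem_tsupport fun hxζ => hx.2 (h.tsupport_inter_subset ⟨hxζ, hx.1⟩)

lemma partialDeriv_eq_zero (h : IsCutoff r K d Ω V W ζ) {x : E n} (hx : x ∈ Ω \ W)
    (i : Fin n) : partialDeriv i ζ x = 0 :=
  image_eq_zero_of_notMem_tsupport fun hxζ =>
    hx.2 (h.tsupport_inter_subset ⟨tsupport_partialDeriv_subset i ζ hxζ, hx.1⟩)

lemma energy_mul_eq_zero (h : IsCutoff r K d Ω V W ζ) (u : E n → ℝ) (g : Fin n → E n → ℝ)
    {x : E n} (hx : x ∈ Ω \ W) : energy (ζ * u) (mulGrad ζ u g) x = 0 := by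
  simp [energy, mulGrad, h.eq_zero hx, h.partialDeriv_eq_zero hx]

lemma hasH1Gradient_mul (h : IsCutoff r K d Ω V W ζ) (hr : 1 ≤ r) {U₀ U : Set (E n)}
    (hU₀ : IsOpen U₀) (hU : IsOpen U) (hUΩ : U ⊆ Ω) (hW : W ∩ U ⊆ U₀) {u : E n → ℝ}
    {g : Fin n → E n → ℝ} (hu : HasH1Gradient U₀ u g) : HasH1Gradient U (ζ * u) (mulGrad ζ u g) :=
  hu.mul_smooth hU₀ hU (h.contDiffOn.mono hUΩ) (fun x _ => h.abs_le_one x)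
    (fun _ hx i => h.abs_partialDeriv_le hr (hUΩ hx) i)
    fun _ hx => hW ⟨h.tsupport_inter_subset ⟨hx.1, hUΩ hx.2⟩, hx.2⟩

end IsCutoff

/-! ### Traces -/

lemma TraceZero.of_abs_le {U Γ : Set (E n)} {u v : E n → ℝ} (h : TraceZero U Γ u)
    (hu : LocallyIntegrable u (volume.restrict U)) (hvu : ∀ x, |v x| ≤ |u x|) :
    TraceZero U Γ v := by
  filter_upwards [h] with x hx hxΓ
  refine squeeze_zero (fun ρ => ?_) (fun ρ => ?_) (hx hxΓ)
  · rw [setAverage_eq]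
    positivity
  · have hint : IntegrableOn u (Metric.ball x ρ ∩ U) := by
      have := (hu.integrableOn_isCompact (isCompact_closedBall x ρ)).mono_set
        Metric.ball_subset_closedBall
      rwa [IntegrableOn, Measure.restrict_restrict Metric.isOpen_ball.measurableSet] at this
    rw [setAverage_eq, setAverage_eq]
    exact smul_le_smul_of_nonneg_left (integral_mono_of_nonneg
      (ae_of_all _ fun _ => abs_nonneg _) hint.abs (ae_of_all _ hvu))
      (inv_nonneg.2 measureReal_nonneg)

/-! ### The bilinear form -/

open Matrix in
/-- The integrand `A g · k + (b · g) v + c u v` of the bilinear form, for functions `u`, `v` with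
gradients `g`, `k`. -/
def Coeffs.density (P : Coeffs n) (u : E n → ℝ) (g : Fin n → E n → ℝ) (v : E n → ℝ)
    (k : Fin n → E n → ℝ) (x : E n) : ℝ :=
  (k · x) ⬝ᵥ P.A x *ᵥ (g · x) + (P.b x).ofLp ⬝ᵥ (g · x) * v x + P.c x * u x * v x

open Matrix in
lemma abs_dotProduct_le {b : Fin n → ℝ} {Λ : ℝ} (hb : ∀ i, |b i| ≤ Λ) (p : Fin n → ℝ) :
    |b ⬝ᵥ p| ≤ Λ * ∑ i, |p i| := by
  rw [Finset.mul_sum]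
  refine (Finset.abs_sum_le_sum_abs _ _).trans (Finset.sum_le_sum fun i _ => ?_)
  rw [abs_mul]
  exact mul_le_mul_of_nonneg_right (hb i) (abs_nonneg _)

open Matrix in
lemma abs_dotProduct_mulVec_le {A : Matrix (Fin n) (Fin n) ℝ} {Λ : ℝ} (hA : ∀ i j, |A i j| ≤ Λ)
    (q p : Fin n → ℝ) : |q ⬝ᵥ A *ᵥ p| ≤ Λ * (∑ i, |p i|) * ∑ i, |q i| := by
  rw [dotProduct_comm]
  exact abs_dotProduct_le (fun i => abs_dotProduct_le (hA i) p) q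

lemma memLp_two_sqrt {α : Type*} {_ : MeasurableSpace α} {μ : Measure α} {f : α → ℝ}
    (hf : Integrable f μ) (hf0 : ∀ x, 0 ≤ f x) : MemLp (fun x => √(f x)) 2 μ := by
  rw [memLp_two_iff_integrable_sq hf.aestronglyMeasurable.aemeasurable.sqrt.aestronglyMeasurable]
  simpa only [Real.sq_sqrt (hf0 _)] using hf

lemma integrable_sqrt_mul_sqrt {α : Type*} {_ : MeasurableSpace α} {μ : Measure α} {f g : α → ℝ}
    (hf : Integrable f μ) (hg : Integrable g μ) (hf0 : ∀ x, 0 ≤ f x) (hg0 : ∀ x, 0 ≤ g x) :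
    Integrable (fun x => √(f x) * √(g x)) μ :=
  (memLp_two_sqrt hf hf0).integrable_mul (memLp_two_sqrt hg hg0)

lemma integral_sqrt_mul_sqrt_le {α : Type*} {_ : MeasurableSpace α} {μ : Measure α} {f g : α → ℝ}
    (hf : Integrable f μ) (hg : Integrable g μ) (hf0 : ∀ x, 0 ≤ f x) (hg0 : ∀ x, 0 ≤ g x) :
    ∫ x, √(f x) * √(g x) ∂μ ≤ √(∫ x, f x ∂μ) * √(∫ x, g x ∂μ) := by
  have h := integral_mul_le_Lp_mul_Lq_of_nonneg (p := 2) (q := 2)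
    ⟨by norm_num, by norm_num, by norm_num⟩ (ae_of_all μ fun x => Real.sqrt_nonneg (f x))
    (ae_of_all μ fun x => Real.sqrt_nonneg (g x))
    (by simpa using memLp_two_sqrt hf hf0) (by simpa using memLp_two_sqrt hg hg0)
  simpa only [Real.rpow_two, Real.sq_sqrt (hf0 _), Real.sq_sqrt (hg0 _),
    ← Real.sqrt_eq_rpow] using h

lemma sq_abs_add_sum_abs_le (a : ℝ) (p : Fin n → ℝ) :
    (|a| + ∑ i, |p i|) ^ 2 ≤ (n + 1) * (a ^ 2 + ∑ i, p i ^ 2) := by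
  have h := sq_sum_le_card_mul_sum_sq (s := (Finset.univ : Finset (Option (Fin n))))
    (f := fun o => o.elim |a| fun i => |p i|)
  simp only [Fintype.sum_option, Option.elim, Finset.card_univ, Fintype.card_option,
    Fintype.card_fin, sq_abs] at h
  exact_mod_cast h

lemma abs_add_sum_abs_le (u : E n → ℝ) (g : Fin n → E n → ℝ) (x : E n) :
    |u x| + ∑ i, |g i x| ≤ √(n + 1) * √(energy u g x) := by
  rw [← Real.sqrt_mul (by positivity)]
  exact Real.le_sqrt_of_sq_le (sq_abs_add_sum_abs_le (u x) (g · x))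

namespace Coeffs

/-- The coefficients are bounded by `Λ` at the point `x`. -/
structure BoundedAt (P : Coeffs n) (Λ : ℝ) (x : E n) : Prop where
  bound_A : ∀ i j, |P.A x i j| ≤ Λ
  bound_b : ∀ i, |P.b x i| ≤ Λ
  bound_c : |P.c x| ≤ Λ

variable {P : Coeffs n} {Λ : ℝ} {u v ζ : E n → ℝ} {g k : Fin n → E n → ℝ} {x : E n}

lemma BoundedAt.nonneg (hP : P.BoundedAt Λ x) : 0 ≤ Λ :=
  (abs_nonneg _).trans hP.bound_c

lemma BoundedAt.abs_density_le (hP : P.BoundedAt Λ x) :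
    |P.density u g v k x| ≤ Λ * (n + 1) * (√(energy u g x) * √(energy v k x)) := by
  set a := ∑ i, |g i x|
  set b := ∑ i, |k i x|
  have hA := abs_dotProduct_mulVec_le hP.bound_A (k · x) (g · x)
  have hb := mul_le_mul_of_nonneg_right (abs_dotProduct_le hP.bound_b (g · x)) (abs_nonneg (v x))
  have hc := mul_le_mul_of_nonneg_right hP.bound_c (by positivity : 0 ≤ |u x| * |v x|)
  have huk : 0 ≤ Λ * (|u x| * b) := mul_nonneg hP.nonneg (by positivity)
  calc |P.density u g v k x| ≤ Λ * a * b + Λ * a * |v x| + Λ * (|u x| * |v x|) := by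
        refine (abs_add_three _ _ _).trans ?_
        rw [abs_mul (_ ⬝ᵥ _), mul_assoc (P.c x), abs_mul (P.c x), abs_mul (u x)]
        exact add_le_add_three hA hb hc
    _ ≤ Λ * ((|u x| + a) * (|v x| + b)) := by linarith
    _ ≤ Λ * ((√(n + 1) * √(energy u g x)) * (√(n + 1) * √(energy v k x))) :=
        mul_le_mul_of_nonneg_left (mul_le_mul (abs_add_sum_abs_le u g x) (abs_add_sum_abs_le v k x)
          (by positivity) (by positivity)) hP.nonneg
    _ = Λ * (√(n + 1) * √(n + 1)) * (√(energy u g x) * √(energy v k x)) := by ring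
    _ = _ := by rw [Real.mul_self_sqrt (by positivity)]

lemma density_sub_right (u : E n → ℝ) (g : Fin n → E n → ℝ) (v v' : E n → ℝ)
    (k k' : Fin n → E n → ℝ) :
    P.density u g (v - v') (k - k') = P.density u g v k - P.density u g v' k' := by
  ext x
  have hk : ((k - k') · x) = (k · x) - (k' · x) := rfl
  rw [Pi.sub_apply]
  unfold density
  rw [hk, sub_dotProduct, Pi.sub_apply]
  ring

open Matrix in
/-- The second order terms cancel: only terms with a factor `∇ζ` remain. -/
lemma density_commutator (P : Coeffs n) (u ζ : E n → ℝ) (g : Fin n → E n → ℝ) (x : E n) :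
    P.density (ζ * u) (mulGrad ζ u g) (ζ * u) (mulGrad ζ u g) x -
        P.density u g (ζ * (ζ * u)) (mulGrad ζ (ζ * u) (mulGrad ζ u g)) x =
      u x * ((mulGrad ζ u g · x) ⬝ᵥ P.A x *ᵥ (partialDeriv · ζ x)) -
        u x * ((partialDeriv · ζ x) ⬝ᵥ P.A x *ᵥ (mulGrad ζ u g · x)) +
        u x ^ 2 * ((partialDeriv · ζ x) ⬝ᵥ P.A x *ᵥ (partialDeriv · ζ x)) +
        ((P.b x).ofLp ⬝ᵥ (partialDeriv · ζ x)) * (u x * (ζ * u) x) := by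
  have mulGrad_apply (v : E n → ℝ) (k : Fin n → E n → ℝ) :
      (mulGrad ζ v k · x) = ζ x • (k · x) + v x • (partialDeriv · ζ x) := by
    ext i
    simp only [mulGrad, Pi.add_apply, Pi.mul_apply, Pi.smul_apply, smul_eq_mul]
    ring
  simp only [density, mulGrad_apply, mulVec_add, mulVec_smul, dotProduct_add, add_dotProduct,
    dotProduct_smul, smul_dotProduct, smul_eq_mul, Pi.mul_apply]
  ring

lemma BoundedAt.abs_density_commutator_le (hP : P.BoundedAt Λ x) {κ : ℝ}
    (hκ : ∀ i, |partialDeriv i ζ x| ≤ κ) :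
    |P.density (ζ * u) (mulGrad ζ u g) (ζ * u) (mulGrad ζ u g) x -
        P.density u g (ζ * (ζ * u)) (mulGrad ζ (ζ * u) (mulGrad ζ u g)) x| ≤
      2 * Λ * (n * κ) * √(n + 1) * (√(u x ^ 2) * √(energy (ζ * u) (mulGrad ζ u g) x)) +
        Λ * (n * κ) ^ 2 * u x ^ 2 := by
  set w := ζ * u
  set k := mulGrad ζ u g
  set τ := ∑ i, |partialDeriv i ζ x|
  set s := ∑ i, |k i x|
  have hτ : τ ≤ n * κ := by
    simpa using Finset.sum_le_card_nsmul Finset.univ _ κ fun i _ => hκ i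
  have hτ0 : 0 ≤ τ := Finset.sum_nonneg fun i _ => abs_nonneg _
  have : 0 ≤ s := Finset.sum_nonneg fun i _ => abs_nonneg _
  have hκ0 : 0 ≤ n * κ := hτ0.trans hτ
  have hΛ := hP.nonneg
  have hkt := abs_dotProduct_mulVec_le hP.bound_A (k · x) (partialDeriv · ζ x)
  have htk := abs_dotProduct_mulVec_le hP.bound_A (partialDeriv · ζ x) (k · x)
  have htt := abs_dotProduct_mulVec_le hP.bound_A (partialDeriv · ζ x) (partialDeriv · ζ x)
  have hb := abs_dotProduct_le hP.bound_b (partialDeriv · ζ x)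
  have huw : 0 ≤ Λ * τ * (|u x| * |w x|) := by positivity
  calc |_| ≤ |u x| * (Λ * τ * s) + |u x| * (Λ * s * τ) + |u x| ^ 2 * (Λ * τ * τ) +
        Λ * τ * (|u x| * |w x|) := by
        rw [density_commutator]
        refine (abs_add_le _ _).trans (add_le_add ((abs_add_le _ _).trans (add_le_add
          ((abs_sub _ _).trans (add_le_add ?_ ?_)) ?_)) ?_)
        all_goals simp only [abs_mul, abs_pow]; gcongr
    _ ≤ 2 * Λ * τ * |u x| * (|w x| + s) + Λ * τ ^ 2 * |u x| ^ 2 := by linarith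
    _ ≤ 2 * Λ * (n * κ) * |u x| * (√(n + 1) * √(energy w k x)) + Λ * (n * κ) ^ 2 * |u x| ^ 2 := by
        gcongr
        exact abs_add_sum_abs_le w k x
    _ = _ := by rw [Real.sqrt_sq_eq_abs, sq_abs]; ring

lemma Admissible.ae_boundedAt {U D : Set (E n)} (hP : P.Admissible U Λ) (hD : D ⊆ U) :
    ∀ᵐ x ∂volume.restrict D, P.BoundedAt Λ x := by
  refine ae_restrict_of_ae_restrict_of_subset hD ?_
  filter_upwards [hP.bound_A, hP.bound_b, hP.bound_c] with x hA hb hc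
  exact ⟨hA, fun i => (PiLp.norm_apply_le (P.b x) i).trans hb, hc⟩

lemma form_eq (P : Coeffs n) {U : Set (E n)} (hU : IsOpen U) (hu : HasH1Gradient U u g)
    (hv : HasH1Gradient U v k) : P.form U u v = ∫ x in U, P.density u g v k x := by
  refine integral_congr_ae ?_
  filter_upwards [hu.weakPartial_ae_eq hU, hv.weakPartial_ae_eq hU] with x hux hvx
  simp only [hux, hvx, density, dotProduct, Matrix.mulVec, Finset.sum_mul, mul_comm (k _ x)]

lemma Admissible.integrableOn_density {U : Set (E n)} (hP : P.Admissible U Λ)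
    (hu : HasH1Gradient U u g) (hv : HasH1Gradient U v k) :
    IntegrableOn (P.density u g v k) U := by
  have hmeas : AEStronglyMeasurable (P.density u g v k) (volume.restrict U) := by
    have hum := hu.memLp.aestronglyMeasurable.aemeasurable
    have hvm := hv.memLp.aestronglyMeasurable.aemeasurable
    have hg (i : Fin n) := (hu.memLp_deriv i).aestronglyMeasurable.aemeasurable
    have hk (i : Fin n) := (hv.memLp_deriv i).aestronglyMeasurable.aemeasurable
    refine AEMeasurable.aestronglyMeasurable (((?_ : AEMeasurable _ _).add
      (AEMeasurable.mul ?_ hvm)).add ((hP.measurable_c.mul hum).mul hvm))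
    · refine Finset.aemeasurable_fun_sum _ fun i _ => (hk i).mul ?_
      exact Finset.aemeasurable_fun_sum Finset.univ fun j _ => (hP.measurable_A i j).mul (hg j)
    · exact Finset.aemeasurable_fun_sum _ fun i _ => (hP.measurable_b i).mul (hg i)
  refine ((integrable_sqrt_mul_sqrt hu.integrable_energy hv.integrable_energy
    (energy_nonneg u g) (energy_nonneg v k)).const_mul (Λ * (n + 1))).mono' hmeas ?_
  filter_upwards [hP.ae_boundedAt subset_rfl] with x hx using hx.abs_density_le

end Coeffs

section Commutator

variable {P : Coeffs n} {Ω Ω₀ V W D : Set (E n)} {Λ K d : ℝ} {r : ℕ} {u ζ : E n → ℝ}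
  {g : Fin n → E n → ℝ}

lemma abs_setIntegral_density_le (hΛ : 0 ≤ Λ) (hP : ∀ᵐ x ∂volume.restrict D, P.BoundedAt Λ x)
    {v : E n → ℝ} {k : Fin n → E n → ℝ} (hu : HasH1Gradient D u g) (hv : HasH1Gradient D v k) :
    |∫ x in D, P.density u g v k x| ≤
      Λ * (n + 1) * (√(∫ x in D, energy u g x) * √(∫ x in D, energy v k x)) := by
  have hint := integrable_sqrt_mul_sqrt hu.integrable_energy hv.integrable_energy
    (energy_nonneg u g) (energy_nonneg v k)
  calc |∫ x in D, P.density u g v k x|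
      ≤ ∫ x in D, Λ * (n + 1) * (√(energy u g x) * √(energy v k x)) := by
        refine norm_integral_le_of_norm_le (f := P.density u g v k) (hint.const_mul _) ?_
        filter_upwards [hP] with x hx using hx.abs_density_le
    _ ≤ _ := by
        rw [integral_const_mul]
        gcongr
        exact integral_sqrt_mul_sqrt_le hu.integrable_energy hv.integrable_energy
          (energy_nonneg u g) (energy_nonneg v k)

lemma IsCutoff.form_sub_form_le (hζ : IsCutoff r K d Ω V W ζ) (hr : 1 ≤ r) (hΩ₀ : IsOpen Ω₀)
    (hΩ₀Ω : Ω₀ ⊆ Ω) (hP : P.Admissible Ω₀ Λ) (hΛ : 0 ≤ Λ) (hK : 0 ≤ K) (hd : 0 ≤ d)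
    (hu : HasH1Gradient Ω₀ u g) (hD : MeasurableSet D) (hWD : W ⊆ D) (hDΩ₀ : D ⊆ Ω₀) :
    P.form Ω₀ (ζ * u) (ζ * u) - P.form Ω₀ u (ζ * (ζ * u)) ≤
      2 * Λ * (n * (K / d)) * √(n + 1) * (√(∫ x in D, u x ^ 2) *
        √(∫ x in Ω₀, energy (ζ * u) (mulGrad ζ u g) x)) +
      Λ * (n * (K / d)) ^ 2 * ∫ x in D, u x ^ 2 := by
  have hw := hζ.hasH1Gradient_mul hr hΩ₀ hΩ₀ hΩ₀Ω inter_subset_right hu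
  have hw₂ := hζ.hasH1Gradient_mul hr hΩ₀ hΩ₀ hΩ₀Ω inter_subset_right hw
  set w := ζ * u
  set k := mulGrad ζ u g
  set c := 2 * Λ * (n * (K / d)) * √(n + 1)
  set F : E n → ℝ :=
    fun x => P.density w k w k x - P.density u g (ζ * w) (mulGrad ζ w k) x
  have hF : ∀ᵐ x ∂volume, x ∈ Ω₀ \ D → F x = 0 := by
    filter_upwards [(ae_restrict_iff' hΩ₀.measurableSet).1 (hP.ae_boundedAt subset_rfl)]
      with x hPx hx
    have hζx (i : Fin n) : |partialDeriv i ζ x| ≤ 0 :=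
      (abs_eq_zero.2 (hζ.partialDeriv_eq_zero ⟨hΩ₀Ω hx.1, fun h => hx.2 (hWD h)⟩ i)).le
    refine abs_nonpos_iff.1 (((hPx hx.1).abs_density_commutator_le hζx).trans_eq ?_)
    ring
  have hu2 := (hu.mono hDΩ₀).memLp.integrable_sq
  have hwD := (hw.mono hDΩ₀).integrable_energy
  have hint : IntegrableOn (fun x => √(u x ^ 2) * √(energy w k x)) D :=
    integrable_sqrt_mul_sqrt hu2 hwD (fun x => sq_nonneg _) (energy_nonneg w k)
  calc P.form Ω₀ w w - P.form Ω₀ u (ζ * w) = ∫ x in D, F x := by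
        rw [P.form_eq hΩ₀ hw hw, P.form_eq hΩ₀ hu hw₂, ← integral_sub
          (hP.integrableOn_density hw hw) (hP.integrableOn_density hu hw₂),
          setIntegral_eq_of_subset_of_ae_sdiff_eq_zero hΩ₀.nullMeasurableSet hDΩ₀ hF]
    _ ≤ ∫ x in D, (c * (√(u x ^ 2) * √(energy w k x)) + Λ * (n * (K / d)) ^ 2 * u x ^ 2) := by
        refine (le_abs_self _).trans (norm_integral_le_of_norm_le (f := F)
          ((hint.const_mul c).add (hu2.const_mul _)) ?_)
        filter_upwards [hP.ae_boundedAt hDΩ₀, ae_restrict_mem hD] with x hPx hx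
        exact hPx.abs_density_commutator_le (hζ.abs_partialDeriv_le hr (hΩ₀Ω (hDΩ₀ hx)))
    _ = c * (∫ x in D, √(u x ^ 2) * √(energy w k x)) +
        Λ * (n * (K / d)) ^ 2 * ∫ x in D, u x ^ 2 := by
        rw [integral_add (hint.const_mul c) (hu2.const_mul _), integral_const_mul,
          integral_const_mul]
    _ ≤ _ := by
        gcongr
        refine (integral_sqrt_mul_sqrt_le hu2 hwD (fun x => sq_nonneg _)
          (energy_nonneg w k)).trans ?_
        gcongr
        · exact ae_of_all _ (energy_nonneg w k)
        · exact hw.integrable_energy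

end Commutator

/-! ### Elementwise estimates -/

lemma meshSize_pos [NeZero n] {T : Set (E n)} (hT : IsOpen T) (hne : T.Nonempty)
    (hb : Bornology.IsBounded T) : 0 < meshSize T := by
  obtain ⟨x, hx⟩ := hne
  exact Metric.diam_pos (infinite_of_mem_nhds x (hT.mem_nhds hx)).nontrivial hb

namespace IsTriangulation

variable {Ω Ω₀ : Set (E n)} {𝒯 : Set (Set (E n))}

lemma ae_exists_mem (h : IsTriangulation Ω Ω₀ 𝒯) : ∀ᵐ x, x ∈ Ω₀ → ∃ T ∈ 𝒯, x ∈ T := by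
  have hnull : ∀ᵐ x : E n, ∀ T ∈ 𝒯, x ∉ frontier T :=
    (ae_ball_iff h.finite.countable).2 fun T hT =>
      measure_eq_zero_iff_ae_notMem.1 (h.null_frontier T hT)
  filter_upwards [hnull] with x hx hxΩ₀
  obtain ⟨T, hT, hxT⟩ := mem_iUnion₂.1 (h.covers hxΩ₀)
  refine ⟨T, hT, by_contra fun hxT' => hx T hT ?_⟩
  rw [(h.isOpen T hT).frontier_eq]
  exact ⟨hxT, hxT'⟩

lemma setIntegral_eq_sum (h : IsTriangulation Ω Ω₀ 𝒯) (hΩ₀ : MeasurableSet Ω₀) {f : E n → ℝ}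
    (hf : IntegrableOn f Ω₀) {𝒮 : Finset (Set (E n))} (h𝒮 : ∀ T ∈ 𝒮, T ∈ 𝒯)
    (h𝒮Ω₀ : ∀ T ∈ 𝒮, T ⊆ Ω₀)
    (hf0 : ∀ T ∈ 𝒯, T ∉ 𝒮 → ∀ᵐ x ∂volume.restrict (T ∩ Ω₀), f x = 0) :
    ∫ x in Ω₀, f x = ∑ T ∈ 𝒮, ∫ x in T, f x := by
  have hzero : ∀ᵐ x, ∀ T ∈ 𝒯, T ∉ 𝒮 → x ∈ T ∩ Ω₀ → f x = 0 := by
    refine (ae_ball_iff h.finite.countable).2 fun T hT => ?_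
    by_cases hT𝒮 : T ∈ 𝒮
    · exact ae_of_all _ fun x hT𝒮' => absurd hT𝒮 hT𝒮'
    · filter_upwards [(ae_restrict_iff' ((h.isOpen T hT).measurableSet.inter hΩ₀)).1
        (hf0 T hT hT𝒮)] with x hx _ using hx
  rw [← integral_biUnion_finset 𝒮 (fun T hT => (h.isOpen T (h𝒮 T hT)).measurableSet)
    (h.pairwiseDisjoint.subset h𝒮) fun T hT => hf.mono_set (h𝒮Ω₀ T hT)]
  refine setIntegral_eq_of_subset_of_ae_sdiff_eq_zero hΩ₀.nullMeasurableSet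
    (iUnion₂_subset h𝒮Ω₀) ?_
  filter_upwards [hzero, h.ae_exists_mem] with x hx hxT hxΩ₀
  obtain ⟨T, hT, hxT⟩ := hxT hxΩ₀.1
  exact hx T hT (fun hT𝒮 => hxΩ₀.2 (mem_biUnion hT𝒮 hxT)) ⟨hxT, hxΩ₀.1⟩

end IsTriangulation

section Elements

variable {P : Coeffs n} {T : Set (E n)} {Λ B C d : ℝ} {u w e : E n → ℝ}
  {g k q : Fin n → E n → ℝ}

/-- The inverse inequality loses a power of the mesh size, which superapproximation regains. -/
lemma abs_setIntegral_density_element_le (hT : IsOpen T) (hΛ : 0 ≤ Λ)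
    (hP : ∀ᵐ x ∂volume.restrict T, P.BoundedAt Λ x) (hu : HasH1Gradient T u g)
    (hw : HasH1Gradient T w k) (he : HasH1Gradient T e q) (hh : 0 < meshSize T) (hd : 0 < d)
    (hC : 0 ≤ C) (hB : 0 ≤ B)
    (hinv : sobolevNorm T 1 2 u ≤ ENNReal.ofReal (C * (meshSize T)⁻¹) * sobolevNorm T 0 2 u)
    (hsup : sobolevNorm T 1 2 e ≤ ENNReal.ofReal B *
      (ENNReal.ofReal (meshSize T / d) * gradNorm T w +
        ENNReal.ofReal (meshSize T / d ^ 2) * l2Norm T u)) :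
    |∫ x in T, P.density u g e q x| ≤ Λ * (n + 1) * C * B / d *
      (√(∫ x in T, u x ^ 2) * √(∫ x in T, energy w k x) + (∫ x in T, u x ^ 2) / d) := by
  set h := meshSize T
  have hY : √(∫ x in T, u x ^ 2) ^ 2 = ∫ x in T, u x ^ 2 :=
    Real.sq_sqrt (integral_nonneg fun x => sq_nonneg (u x))
  set y := √(∫ x in T, u x ^ 2)
  have hu_le : √(∫ x in T, energy u g x) ≤ C * h⁻¹ * y := by
    rwa [hu.sobolevNorm_eq hT, sobolevNorm_zero_two hT (locallyIntegrableOn_of_memLp_two hu.memLp),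
      l2Norm_eq hu.memLp, ← ENNReal.ofReal_mul (by positivity),
      ENNReal.ofReal_le_ofReal_iff (by positivity)] at hinv
  have he_le : √(∫ x in T, energy e q x) ≤
      B * (h / d * √(∫ x in T, energy w k x) + h / d ^ 2 * y) := by
    have hsup' := hsup.trans (mul_le_mul_right (add_le_add_left
      (mul_le_mul_right (gradNorm_le_sobolevNorm T w) _) _) _)
    rwa [he.sobolevNorm_eq hT, hw.sobolevNorm_eq hT, l2Norm_eq hu.memLp,
      ← ENNReal.ofReal_mul (by positivity), ← ENNReal.ofReal_mul (by positivity),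
      ← ENNReal.ofReal_add (by positivity) (by positivity), ← ENNReal.ofReal_mul hB,
      ENNReal.ofReal_le_ofReal_iff (by positivity)] at hsup'
  calc |∫ x in T, P.density u g e q x|
      ≤ Λ * (n + 1) * (√(∫ x in T, energy u g x) * √(∫ x in T, energy e q x)) :=
        abs_setIntegral_density_le hΛ hP hu he
    _ ≤ Λ * (n + 1) * (C * h⁻¹ * y *
          (B * (h / d * √(∫ x in T, energy w k x) + h / d ^ 2 * y))) := by gcongr
    _ = _ := by
        rw [← hY]
        field_simp

lemma sum_setIntegral_le {X : Type*} {m : MeasurableSpace X} {μ : Measure X} {D : Set X}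
    {f : X → ℝ} (hf : IntegrableOn f D μ) (hf0 : ∀ x, 0 ≤ f x) {𝒮 : Finset (Set X)}
    (h𝒮 : ∀ T ∈ 𝒮, MeasurableSet T) (hdisj : (𝒮 : Set (Set X)).PairwiseDisjoint id)
    (h𝒮D : ∀ T ∈ 𝒮, T ⊆ D) : ∑ T ∈ 𝒮, ∫ x in T, f x ∂μ ≤ ∫ x in D, f x ∂μ := by
  rw [← integral_biUnion_finset 𝒮 h𝒮 hdisj fun T hT => hf.mono_set (h𝒮D T hT)]
  exact setIntegral_mono_set hf (ae_of_all _ hf0) (iUnion₂_subset h𝒮D).eventuallyLE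

lemma sum_sqrt_setIntegral_mul_le {X : Type*} {m : MeasurableSpace X} {μ : Measure X}
    {D D' : Set X} {f f' : X → ℝ} (hf : IntegrableOn f D μ) (hf' : IntegrableOn f' D' μ)
    (hf0 : ∀ x, 0 ≤ f x) (hf'0 : ∀ x, 0 ≤ f' x) {𝒮 : Finset (Set X)}
    (h𝒮 : ∀ T ∈ 𝒮, MeasurableSet T) (hdisj : (𝒮 : Set (Set X)).PairwiseDisjoint id)
    (h𝒮D : ∀ T ∈ 𝒮, T ⊆ D) (h𝒮D' : ∀ T ∈ 𝒮, T ⊆ D') :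
    ∑ T ∈ 𝒮, √(∫ x in T, f x ∂μ) * √(∫ x in T, f' x ∂μ) ≤
      √(∫ x in D, f x ∂μ) * √(∫ x in D', f' x ∂μ) :=
  (Real.sum_sqrt_mul_sqrt_le 𝒮 (fun T => integral_nonneg hf0)
    fun T => integral_nonneg hf'0).trans <| by
    gcongr
    · exact sum_setIntegral_le hf hf0 h𝒮 hdisj h𝒮D
    · exact sum_setIntegral_le hf' hf'0 h𝒮 hdisj h𝒮D'

end Elements

lemma LocallyCoercive.integral_energy_le {P : Coeffs n} {Ω Ω₀ : Set (E n)} {d₀ C₁ ρ : ℝ} {z : E n}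
    {w : E n → ℝ} {k : Fin n → E n → ℝ} (h : LocallyCoercive P Ω Ω₀ d₀ C₁) (hΩ : IsOpen Ω)
    (hΩ₀ : IsOpen Ω₀) (hΩ₀Ω : Ω₀ ⊆ Ω) (hρ : 0 < ρ) (hρd₀ : 2 * ρ ≤ d₀) (hw : HasH1Gradient Ω w k)
    (hw0 : ∀ x ∈ Ω \ (Metric.ball z ρ ∩ Ω₀), energy w k x = 0) :
    ∫ x in Ω₀, energy w k x ≤ C₁ * P.form Ω₀ w w := by
  have hmem : w ∈ H1Lt Ω (Metric.ball z ρ ∩ Ω₀) := by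
    refine ⟨hw.mem_H1 hΩ, ae_of_all _ fun x hx => pow_eq_zero_iff two_ne_zero |>.1 ?_⟩
    refine le_antisymm ?_ (sq_nonneg _)
    rw [← hw0 x hx]
    exact le_add_of_nonneg_right (Finset.sum_nonneg fun i _ => sq_nonneg _)
  have hcoer := (h.coercive z ρ hρ hρd₀ w hmem).1
  rw [(hw.mono (inter_subset_right.trans hΩ₀Ω)).sobolevNorm_eq (Metric.isOpen_ball.inter hΩ₀),
    ENNReal.toReal_ofReal (Real.sqrt_nonneg _),
    Real.sq_sqrt (integral_nonneg (energy_nonneg w k))] at hcoer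
  rw [setIntegral_eq_of_subset_of_forall_sdiff_eq_zero hΩ₀.measurableSet inter_subset_right
    fun x hx => hw0 x ⟨hΩ₀Ω hx.1, hx.2⟩]
  exact (inv_mul_le_iff₀ h.C₁_pos).1 hcoer

/-! ### Local approximation of the test function -/

lemma H1Lt_mono {Ω B B' : Set (E n)} (h : B ⊆ B') : H1Lt Ω B ⊆ H1Lt Ω B' := by
  refine fun u hu => ⟨hu.1, ?_⟩
  filter_upwards [hu.2] with x hx hxB' using hx ⟨hxB'.1, fun hxB => hxB'.2 (h hxB)⟩

section Cutoff

variable {Ω Ω₀ U₀ V W ΓD : Set (E n)} {K d : ℝ} {r : ℕ} {u ζ : E n → ℝ} {g : Fin n → E n → ℝ}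

lemma IsCutoff.mul_mem_H1Lt (hζ : IsCutoff r K d Ω V W ζ) (hr : 1 ≤ r) (hΩ : IsOpen Ω)
    (hU₀ : IsOpen U₀) (hW : W ∩ Ω ⊆ U₀) (hu : HasH1Gradient U₀ u g) : ζ * u ∈ H1Lt Ω W := by
  refine ⟨(hζ.hasH1Gradient_mul hr hU₀ hΩ subset_rfl hW hu).mem_H1 hΩ, ae_of_all _ fun x hx => ?_⟩
  rw [Pi.mul_apply, hζ.eq_zero hx, zero_mul]

lemma IsCutoff.mem_H1Lt (hζ : IsCutoff r K d Ω V W ζ) (hr : 1 ≤ r) (hΩ : IsOpen Ω)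
    (hW : IsOpen W) (hWb : Bornology.IsBounded W) : ζ ∈ H1Lt Ω W := by
  have h := hζ.mul_mem_H1Lt hr hΩ hW inter_subset_left
    (hasH1Gradient_const hWb.measure_lt_top.ne 1)
  exact (mul_one ζ ▸ h :)

lemma IsCutoff.mul_mem_H1D0 (hζ : IsCutoff r K d Ω V W ζ) (hr : 1 ≤ r) (hΩ₀ : IsOpen Ω₀)
    (hΩ₀Ω : Ω₀ ⊆ Ω) (hu : u ∈ H1D0 Ω₀ ΓD) : ζ * u ∈ H1D0 Ω₀ ΓD := by
  have hug := hasH1Gradient_of_mem_H1 hΩ₀ hu.1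
  refine ⟨(hζ.hasH1Gradient_mul hr hΩ₀ hΩ₀ hΩ₀Ω inter_subset_right hug).mem_H1 hΩ₀,
    hu.2.of_abs_le (hug.memLp.locallyIntegrable one_le_two) fun x => ?_⟩
  rw [Pi.mul_apply, abs_mul]
  exact mul_le_of_le_one_left (abs_nonneg _) (hζ.abs_le_one x)

end Cutoff

section LocalApproximation

variable {Ω Ω₀ ΓD G : Set (E n)} {𝒯 : Set (Set (E n))} {S : Submodule ℝ (E n → ℝ)} {d : ℝ} {r : ℕ}
  {C₃ : ℝ → ℝ} {z : E n}

lemma LocalApproximation.exists_isLocalInterpolant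
    (h : LocalApproximation Ω Ω₀ ΓD 𝒯 S G (d / 4) d r C₃) (hΩ : IsOpen Ω) (hΩc : IsPreconnected Ω)
    (hG : G ⊂ Ω) (hd : 0 < d) (hz : z ∈ G) (hfr : Disjoint (Metric.ball z d ∩ Ω) (frontier G)) :
    ∃ G₁ I, Metric.ball z (d / 4) ∩ G ⊆ G₁ ∧
      IsLocalInterpolant Ω Ω₀ ΓD S G₁ (Metric.ball z (d / 2) ∩ G) I ∧
      Superapproximation Ω Ω₀ ΓD 𝒯 S G₁ I d r C₃ := by
  have hfr' : Disjoint (Metric.ball z (d / 2) ∩ Ω) (frontier G) :=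
    hfr.mono_left (inter_subset_inter_left _ (Metric.ball_subset_ball (by linarith)))
  have hV := isOpen_ball_inter hΩ hG.1 hfr'
  set V := Metric.ball z (d / 2) ∩ G
  have hball : Metric.ball z (d / 4) ∩ G ⊆
      V ∩ {x | ENNReal.ofReal (d / 4) < Metric.infEDist x (frontier V \ frontier Ω)} := by
    rintro x ⟨hxz, hxG⟩
    rw [Metric.mem_ball] at hxz
    refine ⟨⟨Metric.mem_ball.2 (by linarith), hxG⟩, ?_⟩
    refine lt_of_lt_of_le (b := ENNReal.ofReal (d / 2 - dist x z))
      ((ENNReal.ofReal_lt_ofReal_iff (by linarith)).2 (by linarith))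
      (Metric.le_infEDist.2 fun y hy => ?_)
    have hyz := le_dist_of_mem_frontier hΩ hG.1 hfr' hy
    rw [edist_dist]
    exact ENNReal.ofReal_le_ofReal (by linarith [dist_triangle_left y z x])
  have hdist := setDist_eq_of_isPreconnected hΩ hΩc hV
    (ssubset_of_subset_of_ssubset inter_subset_right hG)
    ⟨z, hball ⟨Metric.mem_ball_self (by linarith), hz⟩⟩
  obtain ⟨I, hI, hsup⟩ := h _ V
    (hV.inter (isOpen_lt continuous_const Metric.continuous_infEDist)) hV inter_subset_left
    inter_subset_right hdist
  exact ⟨_, I, hball, hI, hsup⟩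

lemma LocalApproximation.exists_superapproximation {K : ℝ} {V : Set (E n)} {ζ u : E n → ℝ}
    (h : LocalApproximation Ω Ω₀ ΓD 𝒯 S G (d / 4) d r C₃) (hΩ : IsOpen Ω) (hΩc : IsPreconnected Ω)
    (hΩ₀ : IsOpen Ω₀) (hΩ₀Ω : Ω₀ ⊆ Ω) (hGΩ₀ : G ⊆ Ω₀) (hG : G ⊂ Ω) (hd : 0 < d) (hz : z ∈ G)
    (hfr : Disjoint (Metric.ball z d ∩ Ω) (frontier G)) (hK : 0 < K)
    (hζ : IsCutoff (r + 1) K d Ω V (Metric.ball z (d / 4) ∩ G) ζ) (huS : u ∈ S)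
    (hu : u ∈ H1D0 Ω₀ ΓD) :
    ∃ v ∈ S, v ∈ H1D0 Ω₀ ΓD ∧ v ∈ H1Lt Ω (Metric.ball z (d / 2) ∩ G) ∧
      ∀ T ∈ 𝒯, meshSize T ≤ d → sobolevNorm T 1 2 (ζ * (ζ * u) - v) ≤
        ENNReal.ofReal (C₃ K) * (ENNReal.ofReal (meshSize T / d) * gradNorm T (ζ * u) +
          ENNReal.ofReal (meshSize T / d ^ 2) * l2Norm T u) := by
  have hr : 1 ≤ r + 1 := Nat.le_add_left 1 r
  have hball : IsOpen (Metric.ball z (d / 4) ∩ G) := isOpen_ball_inter hΩ hG.1 <|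
    hfr.mono_left (inter_subset_inter_left _ (Metric.ball_subset_ball (by linarith)))
  have hball_bdd : Bornology.IsBounded (Metric.ball z (d / 4) ∩ G) :=
    Metric.isBounded_ball.subset inter_subset_left
  obtain ⟨G₁, I, hG₁, hI, hsup⟩ := h.exists_isLocalInterpolant hΩ hΩc hG hd hz hfr
  have hw := hζ.hasH1Gradient_mul hr hΩ₀ hΩ subset_rfl
    (fun x hx => hGΩ₀ hx.1.2) (hasH1Gradient_of_mem_H1 hΩ₀ hu.1)
  have hLt : ζ * (ζ * u) ∈ H1Lt Ω G₁ :=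
    H1Lt_mono hG₁ (hζ.mul_mem_H1Lt hr hΩ hΩ inter_subset_right hw)
  have hD0 : ζ * (ζ * u) ∈ H1D0 Ω₀ ΓD :=
    hζ.mul_mem_H1D0 hr hΩ₀ hΩ₀Ω (hζ.mul_mem_H1D0 hr hΩ₀ hΩ₀Ω hu)
  refine ⟨I (ζ * (ζ * u)), (hI.1 _ hLt).1, (hI.2 _ hD0).2, (hI.1 _ hLt).2, fun T hT hTd => ?_⟩
  have hsup' := hsup K hK ζ (hζ.contDiffOn.mono hΩ₀Ω)
    (H1Lt_mono hG₁ (hζ.mem_H1Lt hr hΩ hball hball_bdd))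
    (fun j hj x hx => hζ.norm_iteratedFDeriv_le j (hj.trans (Nat.le_succ r)) x (hΩ₀Ω hx))
    u huS hu T hT hTd
  simp only [pow_two, mul_assoc] at hsup' ⊢
  exact hsup'

end LocalApproximation

/-! ### The energy estimate on a ball -/

lemma Coeffs.Admissible.nonneg {P : Coeffs n} {Ω₀ : Set (E n)} {Λ : ℝ} (hP : P.Admissible Ω₀ Λ)
    (hΩ₀ : IsOpen Ω₀) (hne : Ω₀.Nonempty) : 0 ≤ Λ := by
  have : NeBot (ae (volume.restrict Ω₀)) :=
    ae_restrict_neBot.2 (hΩ₀.measure_pos volume hne).ne'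
  obtain ⟨x, hx⟩ := (hP.ae_boundedAt subset_rfl).exists
  exact hx.nonneg

lemma Coeffs.Admissible.form_sub_right {P : Coeffs n} {Ω₀ : Set (E n)} {Λ : ℝ}
    {u v v' : E n → ℝ} {g k k' : Fin n → E n → ℝ} (hP : P.Admissible Ω₀ Λ) (hΩ₀ : IsOpen Ω₀)
    (hu : HasH1Gradient Ω₀ u g) (hv : HasH1Gradient Ω₀ v k) (hv' : HasH1Gradient Ω₀ v' k') :
    P.form Ω₀ u (v - v') = P.form Ω₀ u v - P.form Ω₀ u v' := by
  rw [P.form_eq hΩ₀ hu (hv.sub hv'), P.form_eq hΩ₀ hu hv, P.form_eq hΩ₀ hu hv', P.density_sub_right]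
  exact integral_sub (hP.integrableOn_density hu hv) (hP.integrableOn_density hu hv')

/-- The inverse inequality between the norms of `H¹(T)` and `L_2(T)`, with constant `C`. -/
def InverseInequality (𝒯 : Set (Set (E n))) (S : Submodule ℝ (E n → ℝ)) (C : ℝ) : Prop :=
  ∀ χ ∈ S, ∀ T ∈ 𝒯,
    sobolevNorm T 1 2 χ ≤ ENNReal.ofReal (C * (meshSize T)⁻¹) * sobolevNorm T 0 2 χ

lemma InverseInequality.mono {𝒯 : Set (Set (E n))} {S : Submodule ℝ (E n → ℝ)} {C C' : ℝ}
    (h : InverseInequality 𝒯 S C) (hC : C ≤ C') : InverseInequality 𝒯 S C' := by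
  refine fun χ hχ T hT => (h χ hχ T hT).trans ?_
  gcongr
  exact inv_nonneg.2 Metric.diam_nonneg

lemma InverseProperties.inverseInequality {𝒯 : Set (Set (E n))} {S : Submodule ℝ (E n → ℝ)}
    {r : ℕ} {C : ℝ} (h : InverseProperties 𝒯 S r C) (hr : 1 ≤ r) : InverseInequality 𝒯 S C := by
  intro χ hχ T hT
  simpa [Real.rpow_neg_one] using h χ hχ T hT 2 2 one_le_two le_rfl 0 1 zero_le_one hr

/-- The function `u ∈ S_{D,0}` is discrete harmonic: `L(u, v) = 0` for all
`v ∈ S_{D,0} ∩ H¹_<(Ω₀)`. -/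
structure IsDiscreteHarmonic (P : Coeffs n) (Ω Ω₀ ΓD : Set (E n)) (S : Submodule ℝ (E n → ℝ))
    (u : E n → ℝ) : Prop where
  mem : u ∈ S
  mem_H1D0 : u ∈ H1D0 Ω₀ ΓD
  form_eq_zero : ∀ v ∈ S, v ∈ H1D0 Ω₀ ΓD → v ∈ H1Lt Ω Ω₀ → P.form Ω₀ u v = 0

section Ball

variable {P : Coeffs n} {Ω Ω₀ V D : Set (E n)} {𝒯 : Set (Set (E n))}
  {S : Submodule ℝ (E n → ℝ)} {Λ B C₂ d : ℝ} {u w e : E n → ℝ} {g k q : Fin n → E n → ℝ}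

lemma IsTriangulation.form_le [NeZero n] (h𝒯 : IsTriangulation Ω Ω₀ 𝒯) (hΩ₀ : IsOpen Ω₀)
    (hP : P.Admissible Ω₀ Λ) (hΛ : 0 ≤ Λ) (hd : 0 < d) (hC₂ : 0 ≤ C₂) (hB : 0 ≤ B)
    (hDΩ₀ : D ⊆ Ω₀) (hVD : ∀ T ∈ 𝒯, (T ∩ V).Nonempty → T ⊆ D ∧ meshSize T ≤ d)
    (hu : HasH1Gradient Ω₀ u g) (hw : HasH1Gradient Ω₀ w k) (he : HasH1Gradient Ω₀ e q)
    (he0 : ∀ᵐ x, x ∈ Ω₀ \ V → e x = 0) (huS : u ∈ S) (hinv : InverseInequality 𝒯 S C₂)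
    (hsup : ∀ T ∈ 𝒯, meshSize T ≤ d → sobolevNorm T 1 2 e ≤ ENNReal.ofReal B *
      (ENNReal.ofReal (meshSize T / d) * gradNorm T w +
        ENNReal.ofReal (meshSize T / d ^ 2) * l2Norm T u)) :
    P.form Ω₀ u e ≤ Λ * (n + 1) * C₂ * B / d * (√(∫ x in D, u x ^ 2) *
      √(∫ x in Ω₀, energy w k x) + (∫ x in D, u x ^ 2) / d) := by
  have h𝒮fin : {T ∈ 𝒯 | (T ∩ V).Nonempty}.Finite := h𝒯.finite.subset (sep_subset _ _)
  obtain ⟨𝒮, h𝒮⟩ : ∃ 𝒮 : Finset (Set (E n)), ∀ T, T ∈ 𝒮 ↔ T ∈ 𝒯 ∧ (T ∩ V).Nonempty :=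
    ⟨h𝒮fin.toFinset, fun T => h𝒮fin.mem_toFinset⟩
  have h𝒮𝒯 (T) (hT : T ∈ 𝒮) : T ∈ 𝒯 := ((h𝒮 T).1 hT).1
  have h𝒮D (T) (hT : T ∈ 𝒮) := hVD T (h𝒮𝒯 T hT) ((h𝒮 T).1 hT).2
  have h𝒮Ω₀ (T) (hT : T ∈ 𝒮) : T ⊆ Ω₀ := (h𝒮D T hT).1.trans hDΩ₀
  have hopen (T) (hT : T ∈ 𝒮) := h𝒯.isOpen T (h𝒮𝒯 T hT)
  have hmeas (T) (hT : T ∈ 𝒮) := (hopen T hT).measurableSet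
  have hdisj := h𝒯.pairwiseDisjoint.subset h𝒮𝒯
  have hoff (T) (hT : T ∈ 𝒯) (hT𝒮 : T ∉ 𝒮) :
      ∀ᵐ x ∂volume.restrict (T ∩ Ω₀), P.density u g e q x = 0 := by
    have hTΩ₀ := (h𝒯.isOpen T hT).inter hΩ₀
    have he0' : e =ᵐ[volume.restrict (T ∩ Ω₀)] 0 := by
      filter_upwards [ae_restrict_of_ae he0, ae_restrict_mem hTΩ₀.measurableSet] with x hx hxT
      exact hx ⟨hxT.2, fun hxV => hT𝒮 ((h𝒮 T).2 ⟨hT, x, hxT.1, hxV⟩)⟩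
    filter_upwards [he0', (he.mono inter_subset_right).gradient_ae_eq_zero hTΩ₀ he0'] with x hx hqx
    simp [Coeffs.density, hx, funext hqx]
  have hu2 : IntegrableOn (fun x => u x ^ 2) D := (hu.mono hDΩ₀).memLp.integrable_sq
  calc P.form Ω₀ u e = ∑ T ∈ 𝒮, ∫ x in T, P.density u g e q x := by
        rw [P.form_eq hΩ₀ hu he, h𝒯.setIntegral_eq_sum hΩ₀.measurableSet
          (hP.integrableOn_density hu he) h𝒮𝒯 h𝒮Ω₀ hoff]
    _ ≤ ∑ T ∈ 𝒮, Λ * (n + 1) * C₂ * B / d * (√(∫ x in T, u x ^ 2) *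
          √(∫ x in T, energy w k x) + (∫ x in T, u x ^ 2) / d) := by
        refine Finset.sum_le_sum fun T hT => (le_abs_self _).trans ?_
        have hmesh := meshSize_pos (hopen T hT) (h𝒯.isConnected T (h𝒮𝒯 T hT)).nonempty
          (h𝒯.isBounded T (h𝒮𝒯 T hT))
        exact abs_setIntegral_density_element_le (hopen T hT) hΛ (hP.ae_boundedAt (h𝒮Ω₀ T hT))
          (hu.mono (h𝒮Ω₀ T hT)) (hw.mono (h𝒮Ω₀ T hT)) (he.mono (h𝒮Ω₀ T hT)) hmesh hd hC₂ hB
          (hinv u huS T (h𝒮𝒯 T hT)) (hsup T (h𝒮𝒯 T hT) (h𝒮D T hT).2)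
    _ ≤ _ := by
        rw [← Finset.mul_sum, Finset.sum_add_distrib, ← Finset.sum_div]
        gcongr
        · exact sum_sqrt_setIntegral_mul_le hu2 hw.integrable_energy (fun x => sq_nonneg _)
            (energy_nonneg w k) hmeas hdisj (fun T hT => (h𝒮D T hT).1) h𝒮Ω₀
        · exact sum_setIntegral_le hu2 (fun x => sq_nonneg _) hmeas hdisj fun T hT => (h𝒮D T hT).1

end Ball

lemma le_mul_of_le_mul_sqrt_mul_sqrt_add {X Y a b : ℝ} (hX : 0 ≤ X) (hY : 0 ≤ Y)
    (h : X ≤ a * (√Y * √X) + b * Y) : X ≤ (a ^ 2 + 2 * b) * Y := by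
  have haY : (a * √Y) ^ 2 = a ^ 2 * Y := by rw [mul_pow, Real.sq_sqrt hY]
  linarith [sq_nonneg (√X - a * √Y), Real.sq_sqrt hX]

/-- The constant in the energy estimate for `ζ u`, at unit scale: `K` bounds the derivatives of
`ζ`, and `B` is the constant of the superapproximation property. -/
noncomputable def energyConst (n : ℕ) (Λ C₁ C₂ B K : ℝ) : ℝ :=
  (C₁ * (2 * Λ * (n * K) * √(n + 1) + Λ * (n + 1) * C₂ * B)) ^ 2 +
    2 * (C₁ * (Λ * (n * K) ^ 2 + Λ * (n + 1) * C₂ * B))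

section DiscreteHarmonic

variable {P : Coeffs n} {Ω Ω₀ ΓD G V : Set (E n)} {𝒯 : Set (Set (E n))}
  {S : Submodule ℝ (E n → ℝ)} {Λ C₁ C₂ K d d₀ : ℝ} {C₃ : ℝ → ℝ} {r : ℕ} {z : E n} {u ζ : E n → ℝ}
  {g : Fin n → E n → ℝ}

/-- By discrete harmonicity, `L(u, ζ²u) = L(u, ζ²u - I(ζ²u))`. -/
lemma IsDiscreteHarmonic.form_mul_mul_le (hu : IsDiscreteHarmonic P Ω Ω₀ ΓD S u)
    (hug : HasH1Gradient Ω₀ u g) (hΩ : IsOpen Ω) (hΩc : IsPreconnected Ω) (hΩ₀ : IsOpen Ω₀)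
    (hΩ₀Ω : Ω₀ ⊆ Ω) (hP : P.Admissible Ω₀ Λ) (h𝒯 : IsTriangulation Ω Ω₀ 𝒯)
    (hinv : InverseInequality 𝒯 S C₂) (hGΩ₀ : G ⊆ Ω₀) (hG : G ⊂ Ω) (hd : 0 < d)
    (happ : LocalApproximation Ω Ω₀ ΓD 𝒯 S G (d / 4) d r C₃)
    (hmesh : ∀ T ∈ 𝒯, (T ∩ G).Nonempty → meshSize T ≤ d / 4) (hz : z ∈ G)
    (hfr : Disjoint (Metric.ball z d ∩ Ω) (frontier G)) (hK : 0 < K)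
    (hζ : IsCutoff (r + 1) K d Ω V (Metric.ball z (d / 4) ∩ G) ζ) :
    P.form Ω₀ u (ζ * (ζ * u)) ≤ Λ * (n + 1) * |C₂| * |C₃ K| / d *
      (√(∫ x in Metric.ball z d ∩ G, u x ^ 2) *
        √(∫ x in Ω₀, energy (ζ * u) (mulGrad ζ u g) x) +
      (∫ x in Metric.ball z d ∩ G, u x ^ 2) / d) := by
  have hr : 1 ≤ r + 1 := Nat.le_add_left 1 r
  have : NeZero n := neZero_of_ssubset ⟨z, hz⟩ hG
  have hΛ : 0 ≤ Λ := hP.nonneg hΩ₀ ⟨z, hGΩ₀ hz⟩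
  obtain ⟨v, hvS, hvD, hvLt, hsup⟩ := happ.exists_superapproximation hΩ hΩc hΩ₀ hΩ₀Ω hGΩ₀ hG hd hz
    hfr hK hζ hu.mem hu.mem_H1D0
  have hw := hζ.hasH1Gradient_mul hr hΩ₀ hΩ₀ hΩ₀Ω inter_subset_right hug
  have hw₂ := hζ.hasH1Gradient_mul hr hΩ₀ hΩ₀ hΩ₀Ω inter_subset_right hw
  have hv := hasH1Gradient_of_mem_H1 hΩ₀ hvD.1
  have he0 : ∀ᵐ x, x ∈ Ω₀ \ (Metric.ball z (d / 2) ∩ G) → (ζ * (ζ * u) - v) x = 0 := by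
    filter_upwards [hvLt.2] with x hx hxV
    have hζx : ζ x = 0 := hζ.eq_zero ⟨hΩ₀Ω hxV.1, fun hxW =>
      hxV.2 ⟨Metric.ball_subset_ball (by linarith) hxW.1, hxW.2⟩⟩
    simp [hζx, hx ⟨hΩ₀Ω hxV.1, hxV.2⟩]
  have hform : P.form Ω₀ u (ζ * (ζ * u)) = P.form Ω₀ u (ζ * (ζ * u) - v) := by
    rw [hP.form_sub_right hΩ₀ hug hw₂ hv, hu.form_eq_zero v hvS hvD
      (H1Lt_mono (inter_subset_right.trans hGΩ₀) hvLt), sub_zero]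
  rw [hform]
  refine h𝒯.form_le hΩ₀ hP hΛ hd (abs_nonneg C₂) (abs_nonneg (C₃ K))
    (inter_subset_right.trans hGΩ₀) (fun T hT hne => ?_) hug hw (hw₂.sub hv) he0 hu.mem
    (hinv.mono (le_abs_self C₂)) fun T hT hTd => (hsup T hT hTd).trans ?_
  · have hTd := hmesh T hT (hne.mono (inter_subset_inter_right T inter_subset_right))
    exact ⟨subset_ball_inter_of_diam_le hfr (h𝒯.isConnected T hT).isPreconnected
      (h𝒯.isBounded T hT) (h𝒯.subset T hT) hne (by rw [meshSize] at hTd; linarith),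
      by linarith⟩
  · gcongr
    exact le_abs_self (C₃ K)

lemma IsDiscreteHarmonic.integral_energy_mul_le (hu : IsDiscreteHarmonic P Ω Ω₀ ΓD S u)
    (hug : HasH1Gradient Ω₀ u g) (hΩ : IsOpen Ω) (hΩc : IsPreconnected Ω) (hΩ₀ : IsOpen Ω₀)
    (hΩ₀Ω : Ω₀ ⊆ Ω) (hP : P.Admissible Ω₀ Λ) (hcoer : LocallyCoercive P Ω Ω₀ d₀ C₁)
    (h𝒯 : IsTriangulation Ω Ω₀ 𝒯) (hinv : InverseInequality 𝒯 S C₂) (hGΩ₀ : G ⊆ Ω₀) (hG : G ⊂ Ω)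
    (hd : 0 < d) (hdd₀ : d ≤ 2 * d₀) (happ : LocalApproximation Ω Ω₀ ΓD 𝒯 S G (d / 4) d r C₃)
    (hmesh : ∀ T ∈ 𝒯, (T ∩ G).Nonempty → meshSize T ≤ d / 4) (hz : z ∈ G)
    (hfr : Disjoint (Metric.ball z d ∩ Ω) (frontier G)) (hK : 0 < K)
    (hζ : IsCutoff (r + 1) K d Ω V (Metric.ball z (d / 4) ∩ G) ζ) :
    ∫ x in Ω₀, energy (ζ * u) (mulGrad ζ u g) x ≤
      energyConst n Λ C₁ |C₂| |C₃ K| K / d ^ 2 * ∫ x in Metric.ball z d ∩ G, u x ^ 2 := by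
  have hr : 1 ≤ r + 1 := Nat.le_add_left 1 r
  have hΛ : 0 ≤ Λ := hP.nonneg hΩ₀ ⟨z, hGΩ₀ hz⟩
  have hW : Metric.ball z (d / 4) ∩ G ⊆ Metric.ball z (d / 4) ∩ Ω₀ :=
    inter_subset_inter_right _ hGΩ₀
  have hcoer' := hcoer.integral_energy_le (z := z) hΩ hΩ₀ hΩ₀Ω (by linarith : 0 < d / 4)
    (by linarith) (hζ.hasH1Gradient_mul hr hΩ₀ hΩ subset_rfl (fun x hx => (hW hx.1).2) hug)
    fun x hx => hζ.energy_mul_eq_zero u g ⟨hx.1, fun hxW => hx.2 (hW hxW)⟩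
  have hcommutator := hζ.form_sub_form_le hr hΩ₀ hΩ₀Ω hP hΛ hK.le hd.le hug
    (isOpen_ball_inter hΩ hG.1 hfr).measurableSet
    (inter_subset_inter_left G (Metric.ball_subset_ball (by linarith)))
    (inter_subset_right.trans hGΩ₀)
  have horth := hu.form_mul_mul_le hug hΩ hΩc hΩ₀ hΩ₀Ω hP h𝒯 hinv hGΩ₀ hG hd happ hmesh hz hfr hK hζ
  set X := ∫ x in Ω₀, energy (ζ * u) (mulGrad ζ u g) x
  set Y := ∫ x in Metric.ball z d ∩ G, u x ^ 2
  have hX : X ≤ C₁ * (2 * Λ * (n * K) * √(n + 1) + Λ * (n + 1) * |C₂| * |C₃ K|) / d *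
        (√Y * √X) +
      C₁ * (Λ * (n * K) ^ 2 + Λ * (n + 1) * |C₂| * |C₃ K|) / d ^ 2 * Y :=
    calc X ≤ C₁ * P.form Ω₀ (ζ * u) (ζ * u) := hcoer'
      _ ≤ C₁ * (_ + _) := mul_le_mul_of_nonneg_left
          ((sub_le_iff_le_add'.1 hcommutator).trans (add_le_add_left horth _)) hcoer.C₁_pos.le
      _ = _ := by field_simp; ring
  refine (le_mul_of_le_mul_sqrt_mul_sqrt_add (integral_nonneg (energy_nonneg _ _))
    (integral_nonneg fun x => sq_nonneg _) hX).trans_eq ?_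
  rw [energyConst]
  ring

lemma IsDiscreteHarmonic.setIntegral_energy_ball_le {η : E n → ℝ}
    (hu : IsDiscreteHarmonic P Ω Ω₀ ΓD S u)
    (hug : HasH1Gradient Ω₀ u g) (hΩ : IsOpen Ω) (hΩc : IsPreconnected Ω) (hΩ₀ : IsOpen Ω₀)
    (hΩ₀Ω : Ω₀ ⊆ Ω) (hP : P.Admissible Ω₀ Λ) (hcoer : LocallyCoercive P Ω Ω₀ d₀ C₁)
    (h𝒯 : IsTriangulation Ω Ω₀ 𝒯) (hinv : InverseInequality 𝒯 S C₂) (hGΩ₀ : G ⊆ Ω₀) (hG : G ⊂ Ω)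
    (hd : 0 < d) (hdd₀ : d ≤ 2 * d₀) (happ : LocalApproximation Ω Ω₀ ΓD 𝒯 S G (d / 4) d r C₃)
    (hmesh : ∀ T ∈ 𝒯, (T ∩ G).Nonempty → meshSize T ≤ d / 4) (hz : z ∈ G)
    (hfr : Disjoint (Metric.ball z d ∩ Ω) (frontier G)) (hK : 0 < K)
    (hη : IsCutoff (r + 1) K d Ω (Metric.ball z (d / 8)) (Metric.ball z (d / 4)) η) :
    ∫ x in Metric.ball z (d / 8) ∩ G, energy u g x ≤
      energyConst n Λ C₁ |C₂| |C₃ K| K / d ^ 2 * ∫ x in Metric.ball z d ∩ G, u x ^ 2 := by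
  have hfr' {ρ : ℝ} (hρ : ρ ≤ d) : Disjoint (Metric.ball z ρ ∩ Ω) (frontier G) :=
    hfr.mono_left (inter_subset_inter_left _ (Metric.ball_subset_ball hρ))
  have hV : IsOpen (Metric.ball z (d / 8) ∩ G) := isOpen_ball_inter hΩ hG.1 (hfr' (by linarith))
  have hζ := hη.indicator (hfr' (by linarith))
  set ζ := G.indicator η
  have hw := hζ.hasH1Gradient_mul (Nat.le_add_left 1 r) hΩ₀ hΩ₀ hΩ₀Ω inter_subset_right hug
  calc ∫ x in Metric.ball z (d / 8) ∩ G, energy u g x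
      = ∫ x in Metric.ball z (d / 8) ∩ G, energy (ζ * u) (mulGrad ζ u g) x :=
        setIntegral_congr_fun hV.measurableSet fun x hx => (hζ.energy_mul_eq hV u g hx).symm
    _ ≤ ∫ x in Ω₀, energy (ζ * u) (mulGrad ζ u g) x :=
        setIntegral_mono_set hw.integrable_energy (ae_of_all _ (energy_nonneg _ _))
          (inter_subset_right.trans hGΩ₀).eventuallyLE
    _ ≤ _ := hu.integral_energy_mul_le hug hΩ hΩc hΩ₀ hΩ₀Ω hP hcoer h𝒯 hinv hGΩ₀ hG hd hdd₀ happ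
        hmesh hz hfr hK hζ

end DiscreteHarmonic

/-! ### Covering by balls -/

/-- The index of the cube of side `s` that contains `x`. -/
noncomputable def cubeIndex (s : ℝ) (x : E n) : Fin n → ℤ := fun i => ⌊x i / s⌋

section CubeIndex

variable {s : ℝ} {x y : E n}

lemma dist_le_of_cubeIndex_eq (hs : 0 < s) (h : cubeIndex s x = cubeIndex s y) :
    dist x y ≤ n * s := by
  have hcoord (i : Fin n) : |x i - y i| ≤ s := by
    have hi := Int.abs_sub_lt_one_of_floor_eq_floor (congrFun h i)
    rw [← sub_div, abs_div, abs_of_pos hs, div_lt_one hs] at hi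
    exact hi.le
  calc dist x y ≤ ∑ i, |x i - y i| := by
        rw [EuclideanSpace.dist_eq]
        refine Real.sqrt_le_iff.2 ⟨Finset.sum_nonneg fun _ _ => abs_nonneg _, ?_⟩
        exact Finset.sum_sq_le_sq_sum_of_nonneg fun _ _ => abs_nonneg _
    _ ≤ n * s := by simpa using Finset.sum_le_sum fun i (_ : i ∈ Finset.univ) => hcoord i

lemma cubeIndex_mem_Icc (hs : 0 < s) {c : ℕ} (h : dist x y ≤ c * s) :
    cubeIndex s x ∈ Finset.Icc (cubeIndex s y - c) (cubeIndex s y + c) := by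
  have hcoord (i : Fin n) : |x i / s - y i / s| ≤ c := by
    rw [← sub_div, abs_div, abs_of_pos hs, div_le_iff₀ hs]
    exact (PiLp.norm_apply_le (x - y) i).trans ((dist_eq_norm x y).symm.trans_le h)
  refine Finset.mem_Icc.2 ⟨fun i => ?_, fun i => ?_⟩
  · rw [Pi.sub_apply, Pi.natCast_apply, cubeIndex, cubeIndex, ← Int.floor_sub_natCast]
    exact Int.floor_mono (by linarith [(abs_le.1 (hcoord i)).1])
  · rw [Pi.add_apply, Pi.natCast_apply, cubeIndex, cubeIndex, ← Int.floor_add_natCast]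
    exact Int.floor_mono (by linarith [(abs_le.1 (hcoord i)).2])

lemma card_Icc_sub_add_natCast (k : Fin n → ℤ) (c : ℕ) :
    (Finset.Icc (k - c) (k + c)).card = (2 * c + 1) ^ n := by
  have hcard (i : Fin n) : (k i + c + 1 - (k i - c)).toNat = 2 * c + 1 := by lia
  simp [Pi.card_Icc, hcard]

lemma encard_inter_closedBall_le (hs : 0 < s) {Z : Set (E n)} (hZ : InjOn (cubeIndex s) Z)
    (c : ℕ) (x : E n) : (Z ∩ Metric.closedBall x (c * s)).encard ≤ ((2 * c + 1) ^ n : ℕ) := by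
  rw [← card_Icc_sub_add_natCast (cubeIndex s x), ← encard_coe_eq_coe_finsetCard]
  exact encard_le_encard_of_injOn (fun z hz => cubeIndex_mem_Icc hs hz.2)
    (hZ.mono inter_subset_left)

lemma exists_subset_injOn_cubeIndex (hs : 0 < s) (G : Set (E n)) :
    ∃ Z ⊆ G, InjOn (cubeIndex s) Z ∧ ∀ x ∈ G, ∃ z ∈ Z, dist x z ≤ n * s := by
  obtain ⟨Z, hZG, hZ⟩ := exists_subset_bijOn G (cubeIndex s)
  refine ⟨Z, hZG, hZ.injOn, fun x hx => ?_⟩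
  obtain ⟨z, hz, hzx⟩ := hZ.surjOn (mem_image_of_mem _ hx)
  exact ⟨z, hz, dist_le_of_cubeIndex_eq hs hzx.symm⟩

end CubeIndex

lemma tsum_setLIntegral_le {α ι : Type*} [MeasurableSpace α] {μ : Measure α} [Countable ι]
    {A : ι → Set α} (hA : ∀ i, MeasurableSet (A i)) {N : ℕ} (hN : ∀ x, {i | x ∈ A i}.encard ≤ N)
    {f : α → ℝ≥0∞} (hf : AEMeasurable f μ) :
    ∑' i, ∫⁻ x in A i, f x ∂μ ≤ N * ∫⁻ x, f x ∂μ := by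
  simp_rw [← lintegral_indicator (hA _)]
  rw [← lintegral_tsum fun i => hf.indicator (hA i), ← lintegral_const_mul'' _ hf]
  refine lintegral_mono fun x => ?_
  calc ∑' i, (A i).indicator f x = ∑' _ : {i | x ∈ A i}, f x :=
        (tsum_subtype {i | x ∈ A i} fun _ => f x).symm
    _ = {i | x ∈ A i}.encard * f x := ENNReal.tsum_set_const _ _
    _ ≤ N * f x := by
        gcongr
        exact_mod_cast hN x

lemma exists_countable_cover_ball (n : ℕ) : ∃ N : ℕ, 0 < N ∧
    ∀ (G : Set (E n)) (d : ℝ), 0 < d → ∃ Z ⊆ G, Z.Countable ∧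
      G ⊆ ⋃ z ∈ Z, Metric.ball z (d / 8) ∧ ∀ x, (Z ∩ Metric.ball x d).encard ≤ N := by
  refine ⟨(2 * (8 * (n + 1)) + 1) ^ n, by positivity, fun G d hd => ?_⟩
  have hs : 0 < d / (8 * (n + 1)) := by positivity
  obtain ⟨Z, hZG, hZ, hcover⟩ := exists_subset_injOn_cubeIndex hs G
  refine ⟨Z, hZG, (mapsTo_univ _ _).countable_of_injOn hZ (to_countable _), fun x hx => ?_,
    fun x => ?_⟩
  · obtain ⟨z, hz, hxz⟩ := hcover x hx
    refine mem_iUnion₂.2 ⟨z, hz, Metric.mem_ball.2 (hxz.trans_lt ?_)⟩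
    rw [mul_div_assoc', div_lt_div_iff₀ (by positivity) (by positivity)]
    linarith
  · refine (encard_mono (inter_subset_inter_right Z ?_)).trans
      (encard_inter_closedBall_le hs hZ (8 * (n + 1)) x)
    refine Metric.ball_subset_closedBall.trans (Metric.closedBall_subset_closedBall (le_of_eq ?_))
    push_cast
    field_simp

lemma exists_setLIntegral_le_of_ball (n : ℕ) : ∃ N : ℕ, 0 < N ∧
    ∀ {G₀ G : Set (E n)} {d : ℝ} {f h : E n → ℝ≥0∞} {c : ℝ≥0∞}, 0 < d → G₀ ⊆ G →
      AEMeasurable h (volume.restrict G) →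
      (∀ z ∈ G₀, ∫⁻ x in Metric.ball z (d / 8) ∩ G, f x ≤
        c * ∫⁻ x in Metric.ball z d ∩ G, h x) →
      ∫⁻ x in G₀, f x ≤ N * c * ∫⁻ x in G, h x := by
  obtain ⟨N, hN, hcover⟩ := exists_countable_cover_ball n
  refine ⟨N, hN, fun {G₀ G d f h c} hd hG₀ hh hball => ?_⟩
  obtain ⟨Z, hZG₀, hZ, hG₀Z, hZN⟩ := hcover G₀ d hd
  have : Countable Z := hZ.to_subtype
  have hoverlap (x : E n) : {z : Z | x ∈ Metric.ball (z : E n) d}.encard ≤ N := by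
    refine le_trans ?_ (hZN x)
    exact encard_le_encard_of_injOn (fun z hz => ⟨z.2, Metric.mem_ball_comm.1 hz⟩)
      Subtype.val_injective.injOn
  have hsub : G₀ ⊆ ⋃ z : Z, Metric.ball (z : E n) (d / 8) ∩ G := by
    rw [← iUnion_inter, iUnion_coe_set]
    exact subset_inter hG₀Z hG₀
  calc ∫⁻ x in G₀, f x
      ≤ ∫⁻ x in ⋃ z : Z, Metric.ball (z : E n) (d / 8) ∩ G, f x := lintegral_mono_set hsub
    _ ≤ ∑' z : Z, ∫⁻ x in Metric.ball (z : E n) (d / 8) ∩ G, f x := lintegral_iUnion_le _ _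
    _ ≤ ∑' z : Z, c * ∫⁻ x in Metric.ball (z : E n) d, h x ∂volume.restrict G := by
        refine ENNReal.tsum_le_tsum fun z => ?_
        rw [Measure.restrict_restrict Metric.isOpen_ball.measurableSet]
        exact hball z (hZG₀ z.2)
    _ ≤ c * (N * ∫⁻ x in G, h x) := by
        rw [ENNReal.tsum_mul_left]
        gcongr
        exact tsum_setLIntegral_le (fun z => Metric.isOpen_ball.measurableSet) hoverlap hh
    _ = N * c * ∫⁻ x in G, h x := by ring

/-! ### The global estimate -/

lemma ssubset_of_setDist_ne_top {X G Ω : Set (E n)} (hG : G ⊆ Ω)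
    (h : setDist X (frontier G \ frontier Ω) ≠ ⊤) : G ⊂ Ω := by
  refine hG.ssubset_of_ne ?_
  rintro rfl
  simp [setDist] at h

section GlobalEstimate

variable {U D D' : Set (E n)} {u : E n → ℝ} {g : Fin n → E n → ℝ} {c : ℝ}

lemma HasH1Gradient.setLIntegral_energy_le (hu : HasH1Gradient U u g) (hD : D ⊆ U) (hD' : D' ⊆ U)
    (hc : 0 ≤ c) (h : ∫ x in D, energy u g x ≤ c * ∫ x in D', u x ^ 2) :
    ∫⁻ x in D, ENNReal.ofReal (energy u g x) ≤
      ENNReal.ofReal c * ∫⁻ x in D', ENNReal.ofReal (u x ^ 2) := by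
  rw [← ofReal_integral_eq_lintegral_ofReal (hu.integrable_energy.mono_set hD)
      (ae_of_all _ (energy_nonneg u g)),
    ← ofReal_integral_eq_lintegral_ofReal (hu.mono hD').memLp.integrable_sq
      (ae_of_all _ fun x => sq_nonneg _), ← ENNReal.ofReal_mul hc]
  exact ENNReal.ofReal_le_ofReal h

lemma HasH1Gradient.h1NormOn_le (hu : HasH1Gradient U u g) (hU : IsOpen U) (hD : D ⊆ U)
    (hc : 0 ≤ c) (h : ∫⁻ x in D, ENNReal.ofReal (energy u g x) ≤
      ENNReal.ofReal c * ∫⁻ x in D', ENNReal.ofReal (u x ^ 2)) :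
    h1NormOn U D u ≤ ENNReal.ofReal √c * l2Norm D' u := by
  rw [hu.h1NormOn_eq hU hD, ENNReal.rpow_inv_le_iff two_pos,
    ENNReal.mul_rpow_of_nonneg _ _ zero_le_two, l2Norm_rpow_two,
    ENNReal.ofReal_rpow_of_nonneg (Real.sqrt_nonneg c) zero_le_two, Real.rpow_two, Real.sq_sqrt hc]
  exact h

end GlobalEstimate

end LocalFEM

theorem lemma3p1_general (n r : ℕ) (Λ C₁ C₂ : ℝ) (C₃ : ℝ → ℝ) :
    ∃ C : ℝ, 0 < C ∧
      ∀ (Ω Ω₀ ΓD : Set (E n)), IsOpen Ω → IsPreconnected Ω → IsOpen Ω₀ → Ω₀ ⊆ Ω →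
      ∀ P : Coeffs n, P.Admissible Ω₀ Λ →
      ∀ d₀ : ℝ, LocallyCoercive P Ω Ω₀ d₀ C₁ →
      ∀ 𝒯 : Set (Set (E n)), IsTriangulation Ω Ω₀ 𝒯 →
      ∀ S : Submodule ℝ (E n → ℝ), InverseInequality 𝒯 S C₂ →
      ∀ (G₀ G : Set (E n)) (d : ℝ), G₀ ⊆ G → G ⊆ Ω₀ → 0 < d → d ≤ 2 * d₀ →
        ENNReal.ofReal d ≤ setDist G₀ (frontier G \ frontier Ω) →
        setDist G₀ (frontier G \ frontier Ω) ≠ ⊤ →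
        LocalApproximation Ω Ω₀ ΓD 𝒯 S G (d / 4) d r C₃ →
        (∀ T ∈ 𝒯, (T ∩ G).Nonempty → meshSize T / d ≤ 1 / 4) →
      ∀ u, IsDiscreteHarmonic P Ω Ω₀ ΓD S u →
        h1NormOn Ω₀ G₀ u ≤ ENNReal.ofReal (C * (1 / d)) * l2Norm G u := by
  obtain ⟨K, hK, hcut⟩ := exists_isCutoff_ball n (r + 1)
  obtain ⟨N, hN, hcover⟩ := exists_setLIntegral_le_of_ball n
  set A := max (energyConst n Λ C₁ |C₂| |C₃ K| K) 1
  have : 0 < A := lt_max_of_lt_right one_pos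
  refine ⟨√(N * A), by positivity, ?_⟩
  intro Ω Ω₀ ΓD hΩ hΩc hΩ₀ hΩ₀Ω P hP d₀ hcoer 𝒯 h𝒯 S hinv G₀ G d hG₀ hG hd hdd₀ hdist hfin happ
    hmesh u hu
  have hug := hasH1Gradient_of_mem_H1 hΩ₀ hu.mem_H1D0.1
  set g := fun i => weakPartial Ω₀ i u
  have hmesh' (T) (hT : T ∈ 𝒯) (hTG : (T ∩ G).Nonempty) : meshSize T ≤ d / 4 := by
    linarith [(div_le_iff₀ hd).1 (hmesh T hT hTG)]
  have hball (z) (hz : z ∈ G₀) : ∫ x in Metric.ball z (d / 8) ∩ G, energy u g x ≤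
      A / d ^ 2 * ∫ x in Metric.ball z d ∩ G, u x ^ 2 := by
    obtain ⟨η, hη⟩ := hcut z d hd Ω
    have hfr := disjoint_ball_inter_frontier hΩ (hdist.trans (iInf₂_le z hz))
    refine (hu.setIntegral_energy_ball_le hug hΩ hΩc hΩ₀ hΩ₀Ω hP hcoer h𝒯 hinv hG
      (ssubset_of_setDist_ne_top (hG.trans hΩ₀Ω) hfin) hd hdd₀ happ hmesh' (hG₀ hz) hfr hK hη).trans
      ?_
    gcongr
    exact le_max_left _ _
  have hC : √(N * A) * (1 / d) = √(N * (A / d ^ 2)) := by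
    rw [← mul_div_assoc (N : ℝ), Real.sqrt_div (by positivity), Real.sqrt_sq hd.le, mul_one_div]
  rw [hC]
  refine hug.h1NormOn_le hΩ₀ (hG₀.trans hG) (by positivity) ?_
  rw [ENNReal.ofReal_mul N.cast_nonneg, ENNReal.ofReal_natCast]
  have huG := (hug.mono hG).memLp.aestronglyMeasurable.aemeasurable
  exact hcover hd hG₀ (huG.pow_const 2).ennreal_ofReal fun z hz =>
     hug.setLIntegral_energy_le (inter_subset_right.trans hG)
      (inter_subset_right.trans hG) (by positivity) (hball z hz)

theorem lemma3p1 (n r₂ r₃ : ℕ) (hr₂ : 1 ≤ r₂) (Λ C₁ C₂ : ℝ) (C₃ : ℝ → ℝ) :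
    ∃ C : ℝ, 0 < C ∧
      ∀ (Ω Ω₀ ΓD : Set (E n)), IsOpen Ω → IsConnected Ω → IsOpen Ω₀ → IsConnected Ω₀ →
        Bornology.IsBounded Ω₀ → Ω₀ ⊆ Ω → ΓD ⊆ frontier Ω ∩ frontier Ω₀ →
      ∀ P : Coeffs n, P.Admissible Ω₀ Λ →
      ∀ d₀ : ℝ, LocallyCoercive P Ω Ω₀ d₀ C₁ →
      ∀ 𝒯 : Set (Set (E n)), IsTriangulation Ω Ω₀ 𝒯 →
      ∀ S : Submodule ℝ (E n → ℝ), InverseProperties 𝒯 S r₂ C₂ →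
      ∀ (G₀ G : Set (E n)) (d : ℝ), G₀ ⊆ G → G ⊆ Ω₀ → 0 < d → d ≤ 2 * d₀ →
        setDist G₀ (frontier G \ frontier Ω) = ENNReal.ofReal d →
        LocalApproximation Ω Ω₀ ΓD 𝒯 S G (d / 4) d r₃ C₃ →
        (∀ T ∈ 𝒯, (T ∩ G).Nonempty → meshSize T / d ≤ 1 / 4) →
      ∀ u_h ∈ S, u_h ∈ H1D0 Ω₀ ΓD →
        (∀ v_h ∈ S, v_h ∈ H1D0 Ω₀ ΓD → v_h ∈ H1Lt Ω Ω₀ → P.form Ω₀ u_h v_h = 0) →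
        h1NormOn Ω₀ G₀ u_h ≤ ENNReal.ofReal (C * (1 / d)) * l2Norm G u_h := by
  obtain ⟨C, hC, h⟩ := lemma3p1_general n r₃ Λ C₁ C₂ C₃
  exact ⟨C, hC, fun Ω Ω₀ ΓD hΩ hΩc hΩ₀ _ _ hΩ₀Ω _ P hP d₀ hcoer 𝒯 h𝒯 S hinv G₀ G d hG₀ hG hd hdd₀
    hdist happ hmesh u huS hu horth => h Ω Ω₀ ΓD hΩ hΩc.isPreconnected hΩ₀ hΩ₀Ω P hP d₀ hcoer 𝒯 h𝒯 S
      (hinv.inverseInequality hr₂) G₀ G d hG₀ hG hd hdd₀ hdist.ge (hdist ▸ ENNReal.ofReal_ne_top)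
      happ hmesh u ⟨huS, hu, horth⟩⟩
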